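/- **Setting.** Let $\widehat p_{\rm rad},\widehat p_{\rm tan}:(0,\infty)^2\to\mathbb R$ be functions of $(\delta,\eta)$ (constitutive functions), and set $\mathcal P_{\rm rad}(x,y)=\widehat p_{\rm rad}(x^3y,x^3)$, $\mathcal P_{\rm tan}(x,y)=\widehat p_{\rm tan}(x^3y,x^3)$, i.e. $x=\eta^{1/3}$, $y=\delta/\eta$. Assume $\mathcal P_{\rm rad},\mathcal P_{\rm tan}\in C^2((0,\infty)^2)$. For $\rho:[0,\infty)\to\mathbb R$ and $\mathcal K>0$ let $m(r)=4\pi\int_0^r\rho(s)s^2\,ds$, $\delta(r)=\rho(r)/\mathcal K$, $\eta(r)=m(r)/(\tfrac{4\pi}{3}\mathcal K r^3)$. A *regular static self-gravitating elastic ball* with reference density $\mathcal K$ and radius $R>0$ is a triple $(\rho,p_{\rm rad},p_{\rm tan})$ of functions on $[0,\infty)$ in $C^0([0,R])\cap C^1((0,R])$ such that $\mathrm{Int}\{r>0:\rho(r)>0\}=(0,R)$; for $r\in(0,R)$ and some potential $\Phi$, $$p_{\rm rad}'=-\tfrac2r(p_{\rm rad}-p_{\rm tan})-\rho\,\Phi',\qquad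 \Phi'=m/r^2;$$ $p_{\rm rad},p_{\rm tan}>0$ on $[0,R)$; $p_{\rm rad}(R)=0$; $p_{\rm rad}(0)=p_{\rm tan}(0)$; $\rho=p_{\rm rad}=p_{\rm tan}=0$ for $r>R$; and $p_{\rm rad}(r)=\widehat p_{\rm rad}(\delta(r),\eta(r))$, $p_{\rm tan}(r)=\widehat p_{\rm tan}(\delta(r),\eta(r))$ for $r\in(0,R]$. **Assumptions.** 1. $\mathcal P_{\rm rad}(1,1)=\mathcal P_{\rm tan}(1,1)=0$, and there are $\mu\ge0$, $\lambda$ with $\lambda+2\mu>0$ such that at $(1,1)$: $\partial_y\mathcal P_{\rm rad}=\lambda+2\mu$, $\partial_x\mathcal P_{\rm rad}=\partial_x\mathcal P_{\rm tan}=3\lambda+2\mu$, $\partial_y\mathcal P_{\rm tan}=\lambda$. 2. $\mathcal P_{\rm rad}(x,1)=\mathcal P_{\rm tan}(x,1)$ for all $x>0$. 3. Put $\Theta(x,y)=\frac{\mathcal P_{\rm tan}(x,y)-\mathcal P_{\rm rad}(x,y)}{1-y}$ for $y\neq1$ and $\Theta(x,1)=\partial_y\mathcal P_{\rm rad}(x,1)-\partial_y\mathcal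 P_{\rm tan}(x,1)$. There are $a,b,c\in\mathbb R$ such that $$\Gamma=(\lambda+2\mu)^{-1}x^ay^b\,\partial_y\mathcal P_{\rm rad},\qquad \Upsilon=(\lambda+2\mu)^{-1}x^ay^{b-1+c}\,(x\partial_x\mathcal P_{\rm rad}+2\Theta)$$ extend continuously to $[0,\infty)^2$ with $\Gamma(0,0)\ne0$ and $\Upsilon(0,0)\neq0$. 4. $a>-4$, $b>0$, $c=0$. 5. There is $X_\flat\in(1,\infty]$ such that $\Gamma(x,1)>0$ and $\Upsilon(x,1)>0$ for $0<x<X_\flat$, and $\Gamma(X_\flat,1)=0$ if $X_\flat<\infty$. 6. $\Gamma,\Upsilon\in C^1([0,\infty)^2)$; $\Gamma>0$ on $[0,X_\flat)\times[0,1)$; and $\Upsilon_0(y)=\Upsilon(0,y)$ satisfies $\Upsilon_0(y)>0$ and $(b\Upsilon_0(y)-y\Upsilon_0'(y))(1-y)+y\Upsilon_0(y)>0$ for $0<y<1$. 7. There is $X_\sharp\in(1,\infty]$ such that $(x,y)\in(0,X_\sharp)\times(0,1)$ and $\mathcal P_{\rm rad}(x,y)\ge0$ imply $\mathcal P_{\rm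 tan}(x,y)>0$; and if $X_\sharp<\infty$ and $\mathcal P_{\rm rad}(X_\sharp,\cdot)$ has a zero in $(0,1)$, then $\mathcal P_{\rm tan}(X_\sharp,\cdot)$ vanishes at some such zero. 8. With $X=\min(X_\flat,X_\sharp)$: $\mathcal P_{\rm rad}(x,1)>0$ for $1<x<X$, and $\mathcal P_{\rm rad}(1,y)<0$ for $0<y<1$. **Theorem.** Under these assumptions let $\Delta_\flat=X_\flat^3$, $\Delta_\sharp=X_\sharp^3$ and $\Delta=\min(\Delta_\flat,\Delta_\sharp)$. Then $\Delta\in(1,\infty]$, and: * $\Delta_\flat$ is the unique element of $(1,\infty]$ such that $\partial_\delta\widehat p_{\rm rad}(\delta,\delta)>0$ for $0<\delta<\Delta_\flat$ and, if $\Delta_\flat<\infty$, $\partial_\delta\widehat p_{\rm rad}(\Delta_\flat,\Delta_\flat)=0$. * $\Delta_\sharp\in(1,\infty]$ has the property that $0<\eta<\Delta_\sharp$, $0<\delta<\eta$ and $\widehat p_{\rm rad}(\delta,\eta)\ge0$ imply $\widehat p_{\rm tan}(\delta,\eta)>0$; and if $\Delta_\sharp<\infty$ and $\widehat p_{\rm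 rad}(\cdot,\Delta_\sharp)$ has a zero in $(0,\Delta_\sharp)$, then $\widehat p_{\rm tan}(\cdot,\Delta_\sharp)$ vanishes at some such zero. If $\Delta_\sharp=\infty$ or $\widehat p_{\rm rad}(\cdot,\Delta_\sharp)$ has a zero in $(0,\Delta_\sharp)$, then $\Delta_\sharp$ is the largest extended real number for which the first of these implications holds, so that $\Delta$ is uniquely determined by $(\widehat p_{\rm rad},\widehat p_{\rm tan})$. * For all $\rho_c,\mathcal K>0$ with $1<\delta_c:=\rho_c/\mathcal K<\Delta$ one has $\widehat p_{\rm rad}(\delta_c,\delta_c)>0$ and $\partial_\delta\widehat p_{\rm rad}(\delta_c,\delta_c)>0$, and there is a unique regular static self-gravitating elastic ball with reference density $\mathcal K$ and central density $\rho(0)=\rho_c$. Its radius $R$ is also unique, and for all $r\in(0,R]$ $$\partial_\delta\widehat p_{\rm rad}(\delta(r),\eta(r))>0,\qquad \rho(r)<\rho_c,\qquad \tfrac{4\pi}{3}\max(\rho(r),\mathcal K)\,r^3<m(r)<\tfrac{4\pi}{3}\rho_c r^3 .$$ -/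

import Mathlib

open Set

noncomputable section

namespace ElasticBall

/-- The open quadrant `(0,∞)²`. -/
def openQuadrant : Set (ℝ × ℝ) := Ioi 0 ×ˢ Ioi 0

/-- The closed quadrant `[0,∞)²`. -/
def closedQuadrant : Set (ℝ × ℝ) := Ici 0 ×ˢ Ici 0

/-- Partial derivative with respect to the first variable. -/
def d1 (f : ℝ → ℝ → ℝ) (s t : ℝ) : ℝ := deriv (fun u => f u t) s

/-- Partial derivative with respect to the second variable. -/
def d2 (f : ℝ → ℝ → ℝ) (s t : ℝ) : ℝ := deriv (fun u => f s u) t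

/-! ### Balls of matter -/

/-- The mass enclosed in the ball of radius `r`: `m(r) = 4π ∫₀ʳ ρ(s) s² ds`. -/
def mass (ρ : ℝ → ℝ) (r : ℝ) : ℝ := 4 * Real.pi * ∫ s in (0 : ℝ)..r, ρ s * s ^ 2

/-- `δ(r) = ρ(r) / 𝒦`. -/
def delta (K : ℝ) (ρ : ℝ → ℝ) (r : ℝ) : ℝ := ρ r / K

/-- `η(r) = m(r) / ((4π/3) 𝒦 r³)`. -/
def eta (K : ℝ) (ρ : ℝ → ℝ) (r : ℝ) : ℝ := mass ρ r / (4 * Real.pi / 3 * K * r ^ 3)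

/-- `f ∈ C⁰([0,R]) ∩ C¹((0,R])`. -/
def RegularProfile (R : ℝ) (f : ℝ → ℝ) : Prop :=
  ContinuousOn f (Icc 0 R) ∧ ContDiffOn ℝ 1 f (Ioc 0 R)

/-- `(ρ, p_rad, p_tan)` is a regular static self-gravitating ball of matter of radius `R`.
Only the values at `r ≥ 0` are meaningful. -/
structure IsRegularBall (R : ℝ) (ρ prad ptan : ℝ → ℝ) : Prop where
  radius_pos : 0 < R
  support : interior {r : ℝ | 0 < r ∧ 0 < ρ r} = Ioo 0 R
  regular_rho : RegularProfile R ρ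
  regular_prad : RegularProfile R prad
  regular_ptan : RegularProfile R ptan
  equilibrium : ∃ Φ : ℝ → ℝ, ∀ r ∈ Ioo 0 R,
    HasDerivAt Φ (mass ρ r / r ^ 2) r ∧
    HasDerivAt prad (-(2 / r) * (prad r - ptan r) - ρ r * deriv Φ r) r
  prad_pos : ∀ r ∈ Ico 0 R, 0 < prad r
  ptan_pos : ∀ r ∈ Ico 0 R, 0 < ptan r
  prad_boundary : prad R = 0
  center : prad 0 = ptan 0
  vacuum : ∀ r, R < r → ρ r = 0 ∧ prad r = 0 ∧ ptan r = 0

/-- A regular ball of matter of radius `R` which is elastic, with reference density `K` and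
constitutive functions `hrad`, `htan` of the variables `(δ, η)`. -/
structure IsRegularElasticBall (hrad htan : ℝ → ℝ → ℝ) (K R : ℝ) (ρ prad ptan : ℝ → ℝ) : Prop
    extends IsRegularBall R ρ prad ptan where
  eos_rad : ∀ r ∈ Ioc 0 R, prad r = hrad (delta K ρ r) (eta K ρ r)
  eos_tan : ∀ r ∈ Ioc 0 R, ptan r = htan (delta K ρ r) (eta K ρ r)

/-! ### Assumptions on the constitutive functions -/

/-- A constitutive function in the variables `x = η^{1/3}`, `y = δ/η`, i.e. `δ = x³y`, `η = x³`. -/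
def inXY (h : ℝ → ℝ → ℝ) (x y : ℝ) : ℝ := h (x ^ 3 * y) (x ^ 3)

/-- `Θ = (P_tan - P_rad) / (1 - y)`, with its continuous extension
`∂_y P_rad - ∂_y P_tan` to `y = 1`. -/
def Theta (Prad Ptan : ℝ → ℝ → ℝ) (x y : ℝ) : ℝ :=
  if y = 1 then d2 Prad x 1 - d2 Ptan x 1 else (Ptan x y - Prad x y) / (1 - y)

/-- The reference configuration is stress-free, and linear elasticity with Lamé coefficients
`lam`, `mu` applies near it. -/
structure LinearElasticAtReference (Prad Ptan : ℝ → ℝ → ℝ) (lam mu : ℝ) : Prop where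
  prad_ref : Prad 1 1 = 0
  ptan_ref : Ptan 1 1 = 0
  dy_prad : d2 Prad 1 1 = lam + 2 * mu
  dx_prad : d1 Prad 1 1 = 3 * lam + 2 * mu
  dy_ptan : d2 Ptan 1 1 = lam
  dx_ptan : d1 Ptan 1 1 = 3 * lam + 2 * mu
  mu_nonneg : 0 ≤ mu
  elliptic : 0 < lam + 2 * mu

/-- The principal pressures agree at the center. -/
def EqualCentralPressures (Prad Ptan : ℝ → ℝ → ℝ) : Prop :=
  ∀ x : ℝ, 0 < x → Prad x 1 = Ptan x 1

/-- Power-law behavior as `x, y → 0⁺`: `Γ` and `Υ` are the continuous extensions to `[0,∞)²` of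
`(λ+2μ)⁻¹ x^a y^b ∂_y P_rad` and `(λ+2μ)⁻¹ x^a y^{b-1+c} (x ∂_x P_rad + 2Θ)`, and they do not
vanish at the origin. -/
structure PowerLawAtZero (Prad Ptan : ℝ → ℝ → ℝ) (lam mu a b c : ℝ) (Γ Υ : ℝ → ℝ → ℝ) :
    Prop where
  gamma_eq : ∀ x y : ℝ, 0 < x → 0 < y →
    Γ x y = (lam + 2 * mu)⁻¹ * x ^ a * y ^ b * d2 Prad x y
  upsilon_eq : ∀ x y : ℝ, 0 < x → 0 < y →
    Υ x y = (lam + 2 * mu)⁻¹ * x ^ a * y ^ (b - 1 + c) *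
      (x * d1 Prad x y + 2 * Theta Prad Ptan x y)
  gamma_cont : ContinuousOn (Function.uncurry Γ) closedQuadrant
  upsilon_cont : ContinuousOn (Function.uncurry Υ) closedQuadrant
  gamma_zero : Γ 0 0 ≠ 0
  upsilon_zero : Υ 0 0 ≠ 0

/-- `X_♭ ∈ (1,∞]` is the first zero of `Γ(·,1)`, and `Υ(·,1)` is positive below `X_♭`. -/
structure CentralHyperbolicity (Γ Υ : ℝ → ℝ → ℝ) (Xflat : EReal) : Prop where
  one_lt : 1 < Xflat
  gamma_pos : ∀ x : ℝ, 0 < x → (x : EReal) < Xflat → 0 < Γ x 1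
  gamma_flat : ∀ x : ℝ, Xflat = (x : EReal) → Γ x 1 = 0
  upsilon_pos : ∀ x : ℝ, 0 < x → (x : EReal) < Xflat → 0 < Υ x 1

/-- `C¹` regularity up to the boundary, positivity of `Γ`, and the inequalities for
`Υ₀(y) = Υ(0,y)`. -/
structure GlobalHyperbolicity (Γ Υ : ℝ → ℝ → ℝ) (b : ℝ) (Xflat : EReal) : Prop where
  gamma_C1 : ContDiffOn ℝ 1 (Function.uncurry Γ) closedQuadrant
  upsilon_C1 : ContDiffOn ℝ 1 (Function.uncurry Υ) closedQuadrant
  gamma_pos : ∀ x y : ℝ, 0 ≤ x → (x : EReal) < Xflat → 0 ≤ y → y < 1 → 0 < Γ x y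
  upsilon_zero_pos : ∀ y : ℝ, 0 < y → y < 1 → 0 < Υ 0 y
  dulac : ∀ y : ℝ, 0 < y → y < 1 →
    0 < (b * Υ 0 y - y * d2 Υ 0 y) * (1 - y) + y * Υ 0 y

/-- `X_♯ ∈ (1,∞]` is such that `P_rad ≥ 0` implies `P_tan > 0` on `(0,X_♯) × (0,1)`, and, if `X_♯`
is finite and `P_rad(X_♯,·)` has a zero in `(0,1)`, then `P_tan(X_♯,·)` vanishes at such a zero. -/
structure TangentialPositivity (Prad Ptan : ℝ → ℝ → ℝ) (Xsharp : EReal) : Prop where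
  one_lt : 1 < Xsharp
  ptan_pos : ∀ x y : ℝ, 0 < x → (x : EReal) < Xsharp → 0 < y → y < 1 →
    0 ≤ Prad x y → 0 < Ptan x y
  boundary : ∀ x : ℝ, Xsharp = (x : EReal) →
    (∃ y ∈ Ioo (0 : ℝ) 1, Prad x y = 0) → ∃ y ∈ Ioo (0 : ℝ) 1, Prad x y = 0 ∧ Ptan x y = 0

/-- Sign of the radial pressure at the center (for `1 < x < X`) and at `x = 1`. -/
structure RadialPressureSigns (Prad : ℝ → ℝ → ℝ) (X : EReal) : Prop where
  center_pos : ∀ x : ℝ, 1 < x → (x : EReal) < X → 0 < Prad x 1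
  neg_at_one : ∀ y : ℝ, 0 < y → y < 1 → Prad 1 y < 0

/-- All the assumptions on the pair `(hrad, htan)` of constitutive functions (in the variables
`(δ, η)`), together with the constants and functions that these assumptions introduce. -/
structure ConstitutiveAssumptions (hrad htan : ℝ → ℝ → ℝ) (lam mu a b c : ℝ)
    (Γ Υ : ℝ → ℝ → ℝ) (Xflat Xsharp : EReal) : Prop where
  rad_C2 : ContDiffOn ℝ 2 (Function.uncurry (inXY hrad)) openQuadrant
  tan_C2 : ContDiffOn ℝ 2 (Function.uncurry (inXY htan)) openQuadrant
  linear : LinearElasticAtReference (inXY hrad) (inXY htan) lam mu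
  equal_center : EqualCentralPressures (inXY hrad) (inXY htan)
  power_law : PowerLawAtZero (inXY hrad) (inXY htan) lam mu a b c Γ Υ
  a_gt : -4 < a
  b_pos : 0 < b
  c_zero : c = 0
  central : CentralHyperbolicity Γ Υ Xflat
  global : GlobalHyperbolicity Γ Υ b Xflat
  tangential : TangentialPositivity (inXY hrad) (inXY htan) Xsharp
  signs : RadialPressureSigns (inXY hrad) (min Xflat Xsharp)

/-! ### The thresholds for the central density, in terms of `(δ, η)` -/

/-- `Δ_♭ ∈ (1,∞]` is the first zero of `δ ↦ ∂_δ p̂_rad(δ,δ)`, which is positive before it. -/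
structure IsDeltaFlat (hrad : ℝ → ℝ → ℝ) (D : EReal) : Prop where
  one_lt : 1 < D
  pos : ∀ δ : ℝ, 0 < δ → (δ : EReal) < D → 0 < d1 hrad δ δ
  zero : ∀ δ : ℝ, D = (δ : EReal) → d1 hrad δ δ = 0

/-- For `0 < η < D` and `0 < δ < η`, `p̂_rad(δ,η) ≥ 0` implies `p̂_tan(δ,η) > 0`. -/
def TanPositiveBelow (hrad htan : ℝ → ℝ → ℝ) (D : EReal) : Prop :=
  ∀ δ η : ℝ, 0 < η → (η : EReal) < D → 0 < δ → δ < η → 0 ≤ hrad δ η → 0 < htan δ η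

/-- The defining property of `Δ_♯ ∈ (1,∞]`. -/
structure IsDeltaSharp (hrad htan : ℝ → ℝ → ℝ) (D : EReal) : Prop where
  one_lt : 1 < D
  pos : TanPositiveBelow hrad htan D
  boundary : ∀ d : ℝ, D = (d : EReal) →
    (∃ δ ∈ Ioo (0 : ℝ) d, hrad δ d = 0) → ∃ δ ∈ Ioo (0 : ℝ) d, hrad δ d = 0 ∧ htan δ d = 0

end ElasticBall

end

namespace ElasticBall

open Filter Topology MeasureTheory Metric
open scoped NNReal

/-! ### Elementary comparison lemmas -/

/-! With `ℓ = log x` and `v = 1 - y`, the definition of the mass gives `r ℓ' = -v`, and hydrostatic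
equilibrium becomes `r v' = -B v + r² G`, where `B = y Υ / Γ` and `G = C x^(a+6) y^(b+1) / Γ`
(`equilibrium_iff`). A ball with central density `ρ_c` corresponds to a solution with `ℓ(0) = log
(ρ_c/𝒦) / 3` and `v(0) = 0`. The system is singular at `r = 0`, but `B` and `G` are positive at the
initial point.

Local existence. Substituting `ℓ = l₀ - r z`, `v = r² w` produces an equation `r u' = H(r,u) - (n+1)
u` for `u = (z,w)`. Its integrated form is a contraction when the Lipschitz constant of `H` is below
`n + 1` (`exists_solution_singular`, `exists_local_solution`).

Continuation. On the rectangle `0 ≤ ℓ ≤ l₀`, `0 ≤ v ≤ 1` the coefficients are regular. Since `G ≥ 0`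
and both coefficients contain the factor `1 - v`, the bounds `0 < v < 1` persist and `ℓ` decreases.
A Lyapunov function of the form `ℓ - θ v + (θ/2) log r` shows that `ℓ` reaches `0` at a finite
radius (`exists_continuation`).

Existence of the ball. The radial pressure is positive at the center and negative where `ℓ = 0`,
that is, where `x = 1`. Its first zero is the radius `R`. The tangential pressure is positive before
`R` by the choice of `X_♯`. The final inequalities express `1 < x < x_c` and `0 < y < 1`.

Uniqueness. Near the center, the combination `β (ℓ₁ - ℓ₂) - (v₁ - v₂)` with `β = B(l₀,0)` cancels
the leading singular term, so a Gronwall estimate applies despite the factor `1/r`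
(`energy_inequality`). Away from the center, ordinary ODE uniqueness propagates the equality. A
competing ball may a priori leave the region `Γ > 0`, so `solution_unique` requires the equations of
the second solution only inside that region. -/

/-- A function which does not increase where it is positive stays nonpositive. -/
theorem nonpos_of_deriv_nonpos_of_pos {f f' : ℝ → ℝ} {a b : ℝ} (hf : ContinuousOn f (Icc a b))
    (hd : ∀ r ∈ Ioo a b, HasDerivAt f (f' r) r) (hs : ∀ r ∈ Ioo a b, 0 < f r → f' r ≤ 0)
    (ha : f a ≤ 0) : ∀ r ∈ Icc a b, f r ≤ 0 := by
  intro r hr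
  by_contra! hpos
  have hsub : Icc a r ⊆ Icc a b := Icc_subset_Icc_right hr.2
  -- The last point before `r` where `f ≤ 0`. Beyond it `f` is positive, hence nonincreasing, and so
  -- cannot have become positive.
  obtain ⟨s, ⟨hsmem, hs0⟩, hmax⟩ : ∃ s, IsGreatest (Icc a r ∩ f ⁻¹' Iic 0) s := by
    refine IsCompact.exists_isGreatest ?_ ⟨a, ⟨le_rfl, hr.1⟩, ha⟩
    exact isCompact_Icc.of_isClosed_subset
      ((hf.mono hsub).preimage_isClosed_of_isClosed isClosed_Icc isClosed_Iic) inter_subset_left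
  have hanti : AntitoneOn f (Icc s r) := by
    refine antitoneOn_of_hasDerivWithinAt_nonpos (f' := f') (convex_Icc s r)
      (hf.mono (Icc_subset_Icc hsmem.1 hr.2)) ?_ ?_
    · intro t ht
      rw [interior_Icc] at ht
      exact (hd t ⟨hsmem.1.trans_lt ht.1, ht.2.trans_le hr.2⟩).hasDerivWithinAt
    · intro t ht
      rw [interior_Icc] at ht
      refine hs t ⟨hsmem.1.trans_lt ht.1, ht.2.trans_le hr.2⟩ ?_
      by_contra! h
      exact absurd (hmax ⟨⟨hsmem.1.trans ht.1.le, ht.2.le⟩, h⟩) (not_le.2 ht.1)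
  have := hanti (left_mem_Icc.2 hsmem.2) (right_mem_Icc.2 hsmem.2) hsmem.2
  have h0 : f s ≤ 0 := hs0
  linarith

/-- A function whose logarithmic derivative is bounded below stays positive. -/
theorem pos_of_deriv_ge {f f' : ℝ → ℝ} {a b N : ℝ} (hN : 0 ≤ N) (hf : ContinuousOn f (Icc a b))
    (hd : ∀ r ∈ Ioo a b, HasDerivAt f (f' r) r)
    (hs : ∀ r ∈ Ioo a b, -(N * max (f r) 0) ≤ f' r) (ha : 0 < f a) :
    ∀ r ∈ Icc a b, 0 < f r := by
  intro r hr
  -- Comparison with the exponential barrier `f(a) exp(-N (r - a))`: the barrier minus `f` does not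
  -- increase where it is positive.
  have key := nonpos_of_deriv_nonpos_of_pos (a := a) (b := b)
    (f := fun r => f a * Real.exp (-(N * (r - a))) - f r)
    (f' := fun r => f a * (Real.exp (-(N * (r - a))) * (-(N * 1))) - f' r)
    (by fun_prop) (fun r hr => ?_) (fun r hr hpos => ?_) (by simp) r hr
  · have : 0 < f a * Real.exp (-(N * (r - a))) := by positivity
    have key : f a * Real.exp (-(N * (r - a))) - f r ≤ 0 := key
    linarith
  · refine HasDerivAt.sub (HasDerivAt.const_mul _ (HasDerivAt.exp ?_)) (hd r hr)
    exact (((hasDerivAt_id r).sub_const a).const_mul N).neg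
  · have h1 := hs r hr
    have h2 : max (f r) 0 ≤ f a * Real.exp (-(N * (r - a))) :=
      max_le (by linarith) (by positivity)
    have := mul_le_mul_of_nonneg_left h2 hN
    linarith

/-- First zero of a continuous function. -/
theorem exists_first_zero {f : ℝ → ℝ} {a b : ℝ} (hab : a ≤ b) (hf : ContinuousOn f (Icc a b))
    (ha : 0 < f a) (hb : f b ≤ 0) : ∃ c ∈ Ioc a b, f c = 0 ∧ ∀ r ∈ Ico a c, 0 < f r := by
  obtain ⟨c, ⟨hc, hc0⟩, hmin⟩ : ∃ c, IsLeast (Icc a b ∩ f ⁻¹' Iic 0) c := by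
    refine IsCompact.exists_isLeast ?_ ⟨b, ⟨hab, le_rfl⟩, hb⟩
    exact isCompact_Icc.of_isClosed_subset
      (hf.preimage_isClosed_of_isClosed isClosed_Icc isClosed_Iic) inter_subset_left
  have hc0 : f c ≤ 0 := hc0
  have hpos : ∀ r ∈ Ico a c, 0 < f r := fun r hr => by
    by_contra! h
    exact absurd (hmin ⟨⟨hr.1, hr.2.le.trans hc.2⟩, h⟩) (not_le.2 hr.2)
  have hac : a < c := hc.1.lt_of_ne (by rintro rfl; linarith)
  refine ⟨c, ⟨hac, hc.2⟩, le_antisymm hc0 ?_, hpos⟩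
  obtain ⟨d, hd, hd0⟩ : (0 : ℝ) ∈ f '' Icc a c :=
    intermediate_value_Icc' hac.le (hf.mono (Icc_subset_Icc_right hc.2)) ⟨hc0, ha.le⟩
  have : d = c := le_antisymm hd.2 (hmin ⟨⟨hd.1, hd.2.trans hc.2⟩, hd0.le⟩)
  rw [← this, hd0]

/-! ### Singular initial value problems -/

/-- If `H` is Lipschitz in its second argument with a constant smaller than `n + 1`, the singular
equation `r u' = H(r,u) - (n+1) u` has a solution which is continuous up to `r = 0`. -/
theorem exists_solution_singular {E : Type*} [NormedAddCommGroup E] [NormedSpace ℝ E]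
    [CompleteSpace E] (n : ℕ) {h : ℝ} (hh : 0 < h) {q : ℝ≥0} (hq : (q : ℝ) < n + 1)
    (H : ℝ → E → E) (hH : Continuous (Function.uncurry H))
    (hL : ∀ r ∈ Icc 0 h, ∀ u v, ‖H r u - H r v‖ ≤ q * ‖u - v‖) :
    ∃ u : ℝ → E, Continuous u ∧ ((n : ℝ) + 1) • u 0 = H 0 (u 0) ∧
      ∀ r ∈ Ioo 0 h, HasDerivAt u (r⁻¹ • (H r (u r) - ((n : ℝ) + 1) • u r)) r := by
  have hn : (0 : ℝ) < n + 1 := by positivity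
  have hHc : ∀ {X : Type _} [TopologicalSpace X] {f : X → ℝ} {g : X → E}, Continuous f →
      Continuous g → Continuous fun x => H (f x) (g x) :=
    fun hf hg => hH.comp (hf.prodMk hg)
  have hext : ∀ φ : C(Icc 0 h, E), Continuous (IccExtend hh.le φ) :=
    fun φ => φ.continuous.Icc_extend'
  -- The equation says `(r^(n+1) u)' = r^n H(r,u)`. Integrating from `0` and substituting `s = t r`
  -- removes the division by `r`, so the operator makes sense at the center.
  let T : C(Icc 0 h, E) → C(Icc 0 h, E) := fun φ =>
    ⟨fun r => ∫ t in (0 : ℝ)..1, t ^ n • H (t * r) (IccExtend hh.le φ (t * r)), by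
      refine intervalIntegral.continuous_parametric_intervalIntegral_of_continuous'
        (f := fun (r : Icc 0 h) t => t ^ n • H (t * r) (IccExtend hh.le φ (t * r))) ?_ 0 1
      refine Continuous.smul (by fun_prop) (hHc (by fun_prop) ((hext φ).comp (by fun_prop)))⟩
  have hTint : ∀ (φ : C(Icc 0 h, E)) (r : ℝ),
      Continuous fun t : ℝ => t ^ n • H (t * r) (IccExtend hh.le φ (t * r)) := fun φ r =>
    Continuous.smul (by fun_prop) (hHc (by fun_prop) ((hext φ).comp (by fun_prop)))
  have hT : ContractingWith (q / (n + 1)) T := by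
    refine ⟨?_, LipschitzWith.of_dist_le_mul fun φ ψ => ?_⟩
    · rw [← NNReal.coe_lt_coe]
      push_cast
      rwa [div_lt_one hn]
    · rw [ContinuousMap.dist_le (by positivity)]
      intro r
      -- The weight `t^n` has integral `1/(n+1)`, which is where the threshold `n + 1` for the
      -- Lipschitz constant comes from.
      have hI : ∫ t in (0 : ℝ)..1, t ^ n * (q * dist φ ψ) = q / (n + 1) * dist φ ψ := by
        rw [intervalIntegral.integral_mul_const, integral_pow]
        simp
        ring
      push_cast
      rw [← hI, dist_eq_norm]
      change ‖(∫ t in (0 : ℝ)..1, t ^ n • H (t * r) (IccExtend hh.le φ (t * r))) -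
        ∫ t in (0 : ℝ)..1, t ^ n • H (t * r) (IccExtend hh.le ψ (t * r))‖ ≤ _
      rw [← intervalIntegral.integral_sub ((hTint φ r).intervalIntegrable _ _)
        ((hTint ψ r).intervalIntegrable _ _)]
      refine intervalIntegral.norm_integral_le_of_norm_le zero_le_one ?_
        (Continuous.intervalIntegrable (by fun_prop) _ _)
      refine Eventually.of_forall fun t ht => ?_
      rw [← smul_sub, norm_smul, norm_pow, Real.norm_of_nonneg ht.1.le]
      have hmem : t * (r : ℝ) ∈ Icc 0 h :=
        ⟨mul_nonneg ht.1.le r.2.1, (mul_le_of_le_one_left r.2.1 ht.2).trans r.2.2⟩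
      refine mul_le_mul_of_nonneg_left ((hL _ hmem _ _).trans ?_) (by have := ht.1; positivity)
      refine mul_le_mul_of_nonneg_left ?_ q.2
      rw [← dist_eq_norm, IccExtend_of_mem _ _ hmem, IccExtend_of_mem _ _ hmem]
      exact ContinuousMap.dist_apply_le_dist _
  obtain ⟨φ, hφ⟩ : ∃ φ, T φ = φ := ⟨_, hT.fixedPoint_isFixedPt⟩
  set u : ℝ → E := IccExtend hh.le φ with hu
  have hfix : ∀ r ∈ Icc 0 h, u r = ∫ t in (0 : ℝ)..1, t ^ n • H (t * r) (u (t * r)) := by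
    intro r hr
    conv_lhs => rw [hu, IccExtend_of_mem _ _ hr, ← hφ]
    rfl
  have huc : Continuous u := hext φ
  refine ⟨u, huc, ?_, ?_⟩
  · have := hfix 0 ⟨le_rfl, hh.le⟩
    simp only [mul_zero] at this
    rw [intervalIntegral.integral_smul_const, integral_pow] at this
    simp only [one_pow, ne_eq, Nat.add_eq_zero_iff, one_ne_zero, and_false, not_false_eq_true,
      zero_pow, sub_zero] at this
    rw [this, smul_smul, ← this]
    rw [mul_one_div_cancel hn.ne', one_smul]
  · have hfc : Continuous fun s : ℝ => s ^ n • H s (u s) :=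
      Continuous.smul (by fun_prop) (hHc continuous_id huc)
    have hfix' : ∀ r ∈ Ioo 0 h, u r = (r ^ (n + 1))⁻¹ • ∫ s in (0 : ℝ)..r, s ^ n • H s (u s) := by
      intro r hr
      have h1 := intervalIntegral.integral_comp_mul_right (a := 0) (b := 1)
        (fun s : ℝ => s ^ n • H s (u s)) hr.1.ne'
      simp only [zero_mul, one_mul, mul_pow, mul_comm _ (r ^ n), mul_smul] at h1
      rw [intervalIntegral.integral_smul, ← hfix r ⟨hr.1.le, hr.2.le⟩] at h1
      have hr0 := hr.1.ne'
      rw [pow_succ, mul_inv, mul_smul, ← h1, smul_smul, inv_mul_cancel₀ (pow_ne_zero _ hr0),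
        one_smul]
    intro r hr
    have hr0 := hr.1.ne'
    have hd : HasDerivAt (fun r => ∫ s in (0 : ℝ)..r, s ^ n • H s (u s)) (r ^ n • H r (u r)) r :=
      intervalIntegral.integral_hasDerivAt_right (hfc.intervalIntegrable _ _)
        (hfc.stronglyMeasurableAtFilter _ _) hfc.continuousAt
    have hd2 : HasDerivAt (fun r : ℝ => (r ^ (n + 1))⁻¹)
        (-(((n + 1 : ℕ) : ℝ) * r ^ n) / (r ^ (n + 1)) ^ 2) r := by
      have := (hasDerivAt_pow (n + 1) r).fun_inv (pow_ne_zero _ hr0)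
      simpa using this
    have hd3 := hd2.smul hd
    have hev : u =ᶠ[𝓝 r] fun r => (r ^ (n + 1))⁻¹ • ∫ s in (0 : ℝ)..r, s ^ n • H s (u s) := by
      filter_upwards [isOpen_Ioo.mem_nhds hr] with s hs using hfix' s hs
    refine (hd3.congr_of_eventuallyEq hev).congr_deriv ?_
    have hI : (∫ s in (0 : ℝ)..r, s ^ n • H s (u s)) = r ^ (n + 1) • u r := by
      rw [hfix' r hr, smul_smul, mul_inv_cancel₀ (pow_ne_zero _ hr0), one_smul]
    rw [hI, smul_sub, smul_smul, smul_smul, smul_smul, sub_eq_add_neg, ← neg_smul]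
    congr 2
    · rw [pow_succ]; field_simp
    · push_cast; field_simp; ring

/-- The projection of `x` to the interval `[a,b]`. -/
def clamp (a b x : ℝ) : ℝ := max a (min b x)

theorem clamp_mem {a b : ℝ} (hab : a ≤ b) (x : ℝ) : clamp a b x ∈ Icc a b :=
  ⟨le_max_left _ _, max_le hab (min_le_left _ _)⟩

theorem clamp_of_mem {a b x : ℝ} (hx : x ∈ Icc a b) : clamp a b x = x := by
  rw [clamp, min_eq_right hx.2, max_eq_right hx.1]

theorem abs_clamp_sub_clamp_le (a b x y : ℝ) : |clamp a b x - clamp a b y| ≤ |x - y| := by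
  unfold clamp
  grind

theorem continuous_clamp (a b : ℝ) : Continuous (clamp a b) := by
  unfold clamp
  fun_prop

theorem clamp_le_max {a b x : ℝ} : clamp a b x ≤ max a x :=
  max_le_max le_rfl (min_le_right _ _)

/-! ### The structure equations

With `ℓ = log x` and `v = 1 - y`, the equations of a ball take the form
`r ℓ' = -v`, `r v' = -B(ℓ,v) v + r² G(ℓ,v)`. -/

/-- `(ℓ, v)` satisfies `r ℓ' = -v`, `r v' = -B(ℓ,v) v + r² G(ℓ,v)` at `r`. -/
def SolvesAt (B G : ℝ × ℝ → ℝ) (l v : ℝ → ℝ) (r : ℝ) : Prop :=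
  HasDerivAt l (-v r / r) r ∧
    HasDerivAt v ((-B (l r, v r) * v r + r ^ 2 * G (l r, v r)) / r) r

/-- `B` and `G` are nonnegative, bounded by `M` and Lipschitz with constant `L` on `s`. -/
structure TameOn (B G : ℝ × ℝ → ℝ) (M L : ℝ) (s : Set (ℝ × ℝ)) : Prop where
  B_nonneg : ∀ p ∈ s, 0 ≤ B p
  B_le : ∀ p ∈ s, B p ≤ M
  G_nonneg : ∀ p ∈ s, 0 ≤ G p
  G_le : ∀ p ∈ s, G p ≤ M
  B_lip : ∀ p ∈ s, ∀ p' ∈ s, |B p - B p'| ≤ L * ‖p - p'‖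
  G_lip : ∀ p ∈ s, ∀ p' ∈ s, |G p - G p'| ≤ L * ‖p - p'‖

/-- `C¹` functions are locally Lipschitz, and strict positivity persists nearby. The sign of `B`
makes the singular term damping in the estimates at the center. -/
theorem exists_tameOn_closedBall {B G : ℝ × ℝ → ℝ} {p₀ : ℝ × ℝ} (hB : ContDiffAt ℝ 1 B p₀)
    (hG : ContDiffAt ℝ 1 G p₀) (hB0 : 0 < B p₀) (hG0 : 0 < G p₀) :
    ∃ ε > 0, ∃ M > 0, ∃ L > 0, TameOn B G M L (closedBall p₀ ε) := by
  obtain ⟨K₁, s₁, hs₁, hK₁⟩ := hB.exists_lipschitzOnWith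
  obtain ⟨K₂, s₂, hs₂, hK₂⟩ := hG.exists_lipschitzOnWith
  have e1 := hB.continuousAt.eventually (lt_mem_nhds hB0)
  have e2 := hG.continuousAt.eventually (lt_mem_nhds hG0)
  have e3 := hB.continuousAt.eventually (gt_mem_nhds (lt_add_one (B p₀)))
  have e4 := hG.continuousAt.eventually (gt_mem_nhds (lt_add_one (G p₀)))
  obtain ⟨ε, hε, hsub⟩ := nhds_basis_closedBall.mem_iff.1
    (inter_mem (inter_mem hs₁ hs₂) ((e1.and e2).and (e3.and e4)))
  refine ⟨ε, hε, B p₀ + 1 + (G p₀ + 1), by positivity, K₁ + K₂ + 1, by positivity, ?_⟩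
  have key : ∀ p ∈ closedBall p₀ ε, (p ∈ s₁ ∧ p ∈ s₂) ∧ (0 < B p ∧ 0 < G p) ∧
      (B p < B p₀ + 1 ∧ G p < G p₀ + 1) := fun p hp => hsub hp
  constructor
  · exact fun p hp => (key p hp).2.1.1.le
  · intro p hp
    have := (key p hp).2.2.1
    linarith
  · exact fun p hp => (key p hp).2.1.2.le
  · intro p hp
    have := (key p hp).2.2.2
    linarith
  · intro p hp p' hp'
    have := hK₁.dist_le_mul p (key p hp).1.1 p' (key p' hp').1.1
    rw [Real.dist_eq, dist_eq_norm] at this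
    nlinarith [norm_nonneg (p - p'), K₂.2, NNReal.coe_nonneg K₂]
  · intro p hp p' hp'
    have := hK₂.dist_le_mul p (key p hp).1.2 p' (key p' hp').1.2
    rw [Real.dist_eq, dist_eq_norm] at this
    nlinarith [norm_nonneg (p - p'), NNReal.coe_nonneg K₁]

theorem TameOn.continuousOn {B G : ℝ × ℝ → ℝ} {M L : ℝ} {s : Set (ℝ × ℝ)} (hL : 0 < L)
    (h : TameOn B G M L s) : ContinuousOn B s ∧ ContinuousOn G s := by
  have : ∀ f : ℝ × ℝ → ℝ, (∀ p ∈ s, ∀ p' ∈ s, |f p - f p'| ≤ L * ‖p - p'‖) →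
      ContinuousOn f s := fun f hf =>
    (LipschitzOnWith.of_dist_le_mul (K := ⟨L, hL.le⟩) fun p hp p' hp' => by
      rw [Real.dist_eq, dist_eq_norm]; exact hf p hp p' hp').continuousOn
  exact ⟨this B h.B_lip, this G h.G_lip⟩

/-- Local existence at the center. -/
theorem exists_local_solution {B G : ℝ × ℝ → ℝ} {l₀ : ℝ} (hB : ContDiffAt ℝ 1 B (l₀, 0))
    (hG : ContDiffAt ℝ 1 G (l₀, 0)) (hB0 : 0 < B (l₀, 0)) (hG0 : 0 < G (l₀, 0)) :
    ∃ h > 0, ∃ l v : ℝ → ℝ, Continuous l ∧ Continuous v ∧ l 0 = l₀ ∧ v 0 = 0 ∧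
      ∀ r ∈ Ioo 0 h, SolvesAt B G l v r ∧ 0 < v r := by
  obtain ⟨ε, hε, M, hM, L, hL, ht⟩ := exists_tameOn_closedBall hB hG hB0 hG0
  -- The only possible limit of `v / r²` at the center: the equation for `w = v / r²` is `r w' = -(2
  -- + B) w + G`.
  set w₀ := G (l₀, 0) / (2 + B (l₀, 0)) with hw₀
  have hw₀pos : 0 < w₀ := by positivity
  -- The term `-B w` may have a large Lipschitz constant. Adding `m w` with `m ≥ B` to both sides
  -- replaces it by `(m - B) w`, whose constant is at most `m`, and the threshold rises by the same
  -- `m`.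
  obtain ⟨m, hm⟩ := exists_nat_ge M
  obtain ⟨h, hh, hh1, hhε, hhε', hhL⟩ : ∃ h > 0, h ≤ 1 / 2 ∧ h ≤ ε ∧ h * (w₀ + 1) ≤ ε ∧
      (w₀ + 2) * L * h ≤ 1 := by
    refine ⟨min (min (1 / 2) ε) (min (ε / (w₀ + 1)) (1 / ((w₀ + 2) * L))), by positivity,
      (min_le_left _ _).trans (min_le_left _ _), (min_le_left _ _).trans (min_le_right _ _), ?_, ?_⟩
    · rw [← le_div_iff₀ (by positivity)]
      exact (min_le_right _ _).trans (min_le_left _ _)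
    · rw [mul_comm, ← le_div_iff₀ (by positivity)]
      exact (min_le_right _ _).trans (min_le_right _ _)
  set cr : ℝ → ℝ := clamp 0 h
  set cw : ℝ → ℝ := clamp (w₀ - 1) (w₀ + 1)
  set cl : ℝ → ℝ := clamp (-1) 1
  have hcr : ∀ r, 0 ≤ cr r ∧ cr r ≤ h := fun r => clamp_mem hh.le r
  have hcw : ∀ w, |cw w| ≤ w₀ + 1 := fun w => by
    have := clamp_mem (a := w₀ - 1) (b := w₀ + 1) (by linarith) w
    rw [abs_le]
    constructor <;> linarith [this.1, this.2]
  have hcl : ∀ z, |cl z| ≤ 1 := fun z => abs_le.2 (clamp_mem (by norm_num) z)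
  -- The point `(ℓ, v) = (l₀ - r z, r² w)`, with all variables truncated so that it stays in the
  -- ball where the coefficients are controlled. The factors `r` make it depend on `u` with
  -- Lipschitz constant `h`.
  set P : ℝ → ℝ × ℝ → ℝ × ℝ := fun r u => (l₀ - cr r * cl u.1, cr r ^ 2 * cw u.2) with hP
  have hPmem : ∀ r u, P r u ∈ closedBall (l₀, (0 : ℝ)) ε := by
    intro r u
    obtain ⟨h0, h1⟩ := hcr r
    rw [mem_closedBall, Prod.dist_eq, Real.dist_eq, Real.dist_eq]
    refine max_le ?_ ?_
    · simp only [hP, sub_sub_cancel_left, abs_neg, abs_mul, abs_of_nonneg h0]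
      nlinarith [hcl u.1, abs_nonneg (cl u.1)]
    · simp only [hP, sub_zero, abs_mul, abs_pow, abs_of_nonneg h0]
      have : cr r ^ 2 ≤ h := by nlinarith
      exact (mul_le_mul this (hcw _) (abs_nonneg _) hh.le).trans hhε'
  have hPlip : ∀ r u u', ‖P r u - P r u'‖ ≤ h * ‖u - u'‖ := by
    intro r u u'
    obtain ⟨h0, h1⟩ := hcr r
    rw [Prod.norm_def]
    refine max_le ?_ ?_
    · have e : (P r u - P r u').1 = -(cr r * (cl u.1 - cl u'.1)) := by simp [hP]; ring
      rw [e, norm_neg, norm_mul, Real.norm_of_nonneg h0]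
      exact mul_le_mul h1 ((abs_clamp_sub_clamp_le _ _ _ _).trans (norm_fst_le (u - u')))
        (norm_nonneg _) hh.le
    · have e : (P r u - P r u').2 = cr r ^ 2 * (cw u.2 - cw u'.2) := by simp [hP]; ring
      rw [e, norm_mul, Real.norm_of_nonneg (by positivity)]
      exact mul_le_mul (by nlinarith) ((abs_clamp_sub_clamp_le _ _ _ _).trans
        (norm_snd_le (u - u'))) (norm_nonneg _) hh.le
  have hPc : Continuous (Function.uncurry P) := by
    have h1 : Continuous cr := continuous_clamp _ _
    have h2 : Continuous cl := continuous_clamp _ _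
    have h3 : Continuous cw := continuous_clamp _ _
    simp only [hP, Function.uncurry_def]
    fun_prop
  set H : ℝ → ℝ × ℝ → ℝ × ℝ := fun r u =>
    ((m + 1) * u.1 + cr r * u.2, (m - B (P r u)) * cw u.2 + G (P r u)) with hH
  have hHc : Continuous (Function.uncurry H) := by
    have h1 : Continuous cr := continuous_clamp _ _
    have h3 : Continuous cw := continuous_clamp _ _
    have hBc : Continuous fun z : ℝ × ℝ × ℝ => B (P z.1 z.2) :=
      (ht.continuousOn hL).1.comp_continuous hPc fun z => hPmem _ _
    have hGc : Continuous fun z : ℝ × ℝ × ℝ => G (P z.1 z.2) :=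
      (ht.continuousOn hL).2.comp_continuous hPc fun z => hPmem _ _
    have hc : Continuous fun z : ℝ × ℝ × ℝ => cw z.2.2 := by fun_prop
    exact Continuous.prodMk (f := fun z : ℝ × ℝ × ℝ => (m + 1) * z.2.1 + cr z.1 * z.2.2)
      (by fun_prop) (((continuous_const.sub hBc).mul hc).add hGc)
  have hHlip : ∀ r ∈ Icc 0 h, ∀ u u', ‖H r u - H r u'‖ ≤ ((m + 3 / 2 : ℝ≥0) : ℝ) * ‖u - u'‖ := by
    intro r _ u u'
    obtain ⟨h0, h1⟩ := hcr r
    have n1 : |u.1 - u'.1| ≤ ‖u - u'‖ := norm_fst_le (u - u')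
    have n2 : |u.2 - u'.2| ≤ ‖u - u'‖ := norm_snd_le (u - u')
    have nn := norm_nonneg (u - u')
    push_cast
    rw [Prod.norm_def]
    refine max_le ?_ ?_
    · have e : (H r u - H r u').1 = (m + 1) * (u.1 - u'.1) + cr r * (u.2 - u'.2) := by
        simp [hH]; ring
      rw [e]
      refine (norm_add_le _ _).trans ?_
      rw [norm_mul, norm_mul, Real.norm_of_nonneg h0, Real.norm_of_nonneg (by positivity),
        Real.norm_eq_abs, Real.norm_eq_abs]
      have a1 : (m + 1 : ℝ) * |u.1 - u'.1| ≤ (m + 1) * ‖u - u'‖ := by gcongr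
      have a2 : cr r * |u.2 - u'.2| ≤ 1 / 2 * ‖u - u'‖ :=
        mul_le_mul (h1.trans hh1) n2 (abs_nonneg _) (by norm_num)
      linarith
    · have e : (H r u - H r u').2 = (m - B (P r u)) * (cw u.2 - cw u'.2) +
          (-(B (P r u) - B (P r u')) * cw u'.2 + (G (P r u) - G (P r u'))) := by
        simp [hH]; ring
      rw [e]
      refine (norm_add_le _ _).trans ?_
      have hb0 := ht.B_nonneg _ (hPmem r u)
      have hb1 := ht.B_le _ (hPmem r u)
      have a1 : ‖(m - B (P r u)) * (cw u.2 - cw u'.2)‖ ≤ m * ‖u - u'‖ := by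
        rw [norm_mul]
        refine mul_le_mul ?_ ((abs_clamp_sub_clamp_le _ _ _ _).trans n2) (norm_nonneg _)
          (by positivity)
        rw [Real.norm_of_nonneg (by linarith)]
        linarith
      have a2 : ‖-(B (P r u) - B (P r u')) * cw u'.2‖ ≤ L * (h * ‖u - u'‖) * (w₀ + 1) := by
        rw [norm_mul, norm_neg]
        refine mul_le_mul ((ht.B_lip _ (hPmem r u) _ (hPmem r u')).trans ?_) (hcw _)
          (abs_nonneg _) (by positivity)
        have := hPlip r u u'
        gcongr
      have a3 : ‖G (P r u) - G (P r u')‖ ≤ L * (h * ‖u - u'‖) := by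
        refine (ht.G_lip _ (hPmem r u) _ (hPmem r u')).trans ?_
        have := hPlip r u u'
        gcongr
      have a4 := norm_add_le (-(B (P r u) - B (P r u')) * cw u'.2) (G (P r u) - G (P r u'))
      have a5 := mul_le_mul_of_nonneg_right hhL nn
      nlinarith
  -- Here `n = m + 1`. The threshold is `m + 2`, and the small step `h` left only `1/2` above `m +
  -- 1` or `m` in the Lipschitz bounds of the components.
  obtain ⟨u, huc, hu0, hu⟩ := exists_solution_singular (m + 1) hh (q := m + 3 / 2)
    (by push_cast; linarith) H hHc hHlip
  have hcr0 : cr 0 = 0 := clamp_of_mem ⟨le_rfl, hh.le⟩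
  have hP0 : ∀ u, P 0 u = (l₀, 0) := fun u => by simp [hP, hcr0]
  have hcw0 : cw w₀ = w₀ := clamp_of_mem ⟨by linarith, by linarith⟩
  have hw0 : u 0 = (0, w₀) := by
    rw [Prod.ext_iff] at hu0
    simp only [hH, Prod.smul_fst, Prod.smul_snd, smul_eq_mul, hP0, hcr0, zero_mul] at hu0
    push_cast at hu0
    refine Prod.ext (by linarith [hu0.1]) ?_
    have e0 : (m + 1 + 1) * w₀ = (m - B (l₀, 0)) * w₀ + G (l₀, 0) := by
      rw [hw₀]; field_simp; ring
    -- Truncation is `1`-Lipschitz and `m - B < m + 2`, so the truncated equation at the center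
    -- still has `w₀` as its only solution.
    have e1 : (m + 1 + 1) * ((u 0).2 - w₀) = (m - B (l₀, 0)) * (cw (u 0).2 - cw w₀) := by
      rw [hcw0]; linarith [hu0.2]
    have e2 := congrArg abs e1
    have hb1 : B (l₀, 0) ≤ M := ht.B_le _ (mem_closedBall_self hε.le)
    rw [abs_mul, abs_mul, abs_of_nonneg (by positivity),
      abs_of_nonneg (show 0 ≤ m - B (l₀, 0) by linarith)] at e2
    have e3 := mul_le_mul_of_nonneg_left
      (abs_clamp_sub_clamp_le (w₀ - 1) (w₀ + 1) (u 0).2 w₀)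
      (show 0 ≤ m - B (l₀, 0) by linarith)
    have e4 : |(u 0).2 - w₀| = 0 := by
      have := abs_nonneg ((u 0).2 - w₀)
      have e5 : (m + 1 + 1) * |(u 0).2 - w₀| ≤ (m - B (l₀, 0)) * |(u 0).2 - w₀| := e2.le.trans e3
      nlinarith
    simpa [sub_eq_zero] using e4
  -- The value `(0, w₀)` lies strictly inside the truncation windows, so near the center the
  -- truncations are inactive.
  have hev : ∀ᶠ r in 𝓝 (0 : ℝ), (u r).1 ∈ Ioo (-1 : ℝ) 1 ∧ (u r).2 ∈ Ioo (w₀ - 1) (w₀ + 1) ∧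
      0 < (u r).2 := by
    have c1 : ContinuousAt (fun r => (u r).1) 0 := by fun_prop
    have c2 : ContinuousAt (fun r => (u r).2) 0 := by fun_prop
    refine (c1.eventually (isOpen_Ioo.mem_nhds ?_)).and ((c2.eventually
      (isOpen_Ioo.mem_nhds ?_)).and (c2.eventually (isOpen_Ioi.mem_nhds ?_)))
    · simp [hw0]
    · simp [hw0]
    · simpa [hw0] using hw₀pos
  obtain ⟨η, hη, hball⟩ := Metric.eventually_nhds_iff.1 hev
  refine ⟨min h η, by positivity, fun r => l₀ - r * (u r).1, fun r => r ^ 2 * (u r).2,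
    by fun_prop, by fun_prop, by simp, by simp, fun r hr => ?_⟩
  have hr0 : r ≠ 0 := hr.1.ne'
  have hrh : r < h := hr.2.trans_le (min_le_left _ _)
  obtain ⟨b1, b2, b3⟩ := hball (y := r) (by
    rw [Real.dist_eq, sub_zero, abs_of_pos hr.1]; exact hr.2.trans_le (min_le_right _ _))
  have d := hu r ⟨hr.1, hrh⟩
  have d1 : HasDerivAt (fun r => (u r).1) _ r := (hasFDerivAt_fst (p := u r)).comp_hasDerivAt r d
  have d2 : HasDerivAt (fun r => (u r).2) _ r := (hasFDerivAt_snd (p := u r)).comp_hasDerivAt r d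
  have ecr : cr r = r := clamp_of_mem ⟨hr.1.le, hrh.le⟩
  have ecw : cw (u r).2 = (u r).2 := clamp_of_mem (Ioo_subset_Icc_self b2)
  have ecl : cl (u r).1 = (u r).1 := clamp_of_mem (Ioo_subset_Icc_self b1)
  have eP : P r (u r) = (l₀ - r * (u r).1, r ^ 2 * (u r).2) := by simp [hP, ecr, ecw, ecl]
  refine ⟨⟨?_, ?_⟩, mul_pos (pow_pos hr.1 2) b3⟩
  · refine (((hasDerivAt_id r).mul d1).const_sub l₀).congr_deriv ?_
    simp [hH, ecr]
    field_simp
    ring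
  · refine ((hasDerivAt_pow 2 r).mul d2).congr_deriv ?_
    simp [hH, ecr, ecw, eP]
    field_simp
    ring

/-! ### Continuation until `ℓ = 0` -/

/-- A bounded, globally Lipschitz, time-dependent vector field has solutions on any interval. -/
theorem exists_solution_of_lipschitz {E : Type*} [NormedAddCommGroup E] [NormedSpace ℝ E]
    [CompleteSpace E] {f : ℝ → E → E} {a T : ℝ} (haT : a ≤ T) {K L : ℝ≥0}
    (hK : ∀ t ∈ Icc a T, LipschitzWith K (f t)) (hc : ∀ x, ContinuousOn (f · x) (Icc a T))
    (hb : ∀ t ∈ Icc a T, ∀ x, ‖f t x‖ ≤ L) (x₀ : E) :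
    ∃ α : ℝ → E, α a = x₀ ∧ ∀ t ∈ Icc a T, HasDerivWithinAt α (f t (α t)) (Icc a T) t := by
  have hpl : IsPicardLindelof f (⟨a, le_rfl, haT⟩ : Icc a T) x₀ (L * (T - a).toNNReal) 0 L K := by
    refine ⟨fun t ht => (hK t ht).lipschitzOnWith, fun x _ => hc x, fun t ht x _ => hb t ht x, ?_⟩
    simp [Real.coe_toNNReal _ (sub_nonneg.2 haT), max_eq_left (sub_nonneg.2 haT)]
  exact hpl.exists_eq_forall_mem_Icc_hasDerivWithinAt₀

theorem exists_lipschitzOnWith_of_contDiffOn {E F : Type*} [NormedAddCommGroup E]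
    [NormedSpace ℝ E] [NormedAddCommGroup F] [NormedSpace ℝ F] {f : E → F} {s : Set E}
    (hf : ContDiffOn ℝ 1 f s) (hs : Convex ℝ s) (hs' : IsCompact s) :
    ∃ K, LipschitzOnWith K f s :=
  LocallyLipschitzOn.exists_lipschitzOnWith_of_compact hs' fun _ hx =>
    (hf _ hx).exists_lipschitzOnWith hs

/-- The rectangle `[0,l₀] × [0,1]`. -/
def rect (l₀ : ℝ) : Set (ℝ × ℝ) := Icc 0 l₀ ×ˢ Icc 0 1

/-- The projection to `rect l₀`. -/
def clampRect (l₀ : ℝ) (p : ℝ × ℝ) : ℝ × ℝ := (clamp 0 l₀ p.1, clamp 0 1 p.2)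

theorem clampRect_mem {l₀ : ℝ} (hl₀ : 0 ≤ l₀) (p : ℝ × ℝ) : clampRect l₀ p ∈ rect l₀ :=
  ⟨clamp_mem hl₀ _, clamp_mem zero_le_one _⟩

theorem clampRect_of_mem {l₀ : ℝ} {p : ℝ × ℝ} (hp : p ∈ rect l₀) : clampRect l₀ p = p :=
  Prod.ext (clamp_of_mem hp.1) (clamp_of_mem hp.2)

theorem norm_clampRect_sub_le (l₀ : ℝ) (p q : ℝ × ℝ) :
    ‖clampRect l₀ p - clampRect l₀ q‖ ≤ ‖p - q‖ :=
  max_le ((abs_clamp_sub_clamp_le _ _ _ _).trans (norm_fst_le (p - q)))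
    ((abs_clamp_sub_clamp_le _ _ _ _).trans (norm_snd_le (p - q)))

theorem isCompact_rect (l₀ : ℝ) : IsCompact (rect l₀) := isCompact_Icc.prod isCompact_Icc

theorem convex_rect (l₀ : ℝ) : Convex ℝ (rect l₀) := (convex_Icc _ _).prod (convex_Icc _ _)

/-- The hypotheses on the coefficients `B = (1 - v) B₁`, `G = (1 - v) G₁` which allow to continue
solutions until `ℓ = 0`. -/
structure ContinuationHyp (B₁ G₁ B G : ℝ × ℝ → ℝ) (l₀ : ℝ) : Prop where
  B_eq : ∀ p, B p = (1 - p.2) * B₁ p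
  G_eq : ∀ p, G p = (1 - p.2) * G₁ p
  B_C1 : ContDiffOn ℝ 1 B (rect l₀)
  G_C1 : ContDiffOn ℝ 1 G (rect l₀)
  B₁_cont : ContinuousOn B₁ (rect l₀)
  G₁_cont : ContinuousOn G₁ (rect l₀)
  G₁_nonneg : ∀ p ∈ rect l₀, 0 ≤ G₁ p
  G₁_pos : ∀ p ∈ rect l₀, p.2 < 1 → 0 < G₁ p

/-- Solutions on arbitrarily long intervals for the coefficients clamped to the rectangle. -/
theorem ContinuationHyp.exists_clamped_solution {B₁ G₁ B G : ℝ × ℝ → ℝ} {l₀ : ℝ}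
    (hyp : ContinuationHyp B₁ G₁ B G l₀) (hl₀ : 0 ≤ l₀) {a T : ℝ} (ha : 0 < a) (haT : a ≤ T)
    (p₀ : ℝ × ℝ) :
    ∃ l v : ℝ → ℝ, (l a, v a) = p₀ ∧ ∀ r ∈ Icc a T,
      HasDerivWithinAt l (-(clampRect l₀ (l r, v r)).2 / r) (Icc a T) r ∧
      HasDerivWithinAt v ((-B (clampRect l₀ (l r, v r)) * (clampRect l₀ (l r, v r)).2 +
        r ^ 2 * G (clampRect l₀ (l r, v r))) / r) (Icc a T) r := by
  set F : ℝ × ℝ → ℝ := fun p => -B p * p.2 with hF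
  have hFC : ContDiffOn ℝ 1 F (rect l₀) := hyp.B_C1.neg.mul contDiff_snd.contDiffOn
  obtain ⟨KF, hKF⟩ := exists_lipschitzOnWith_of_contDiffOn hFC (convex_rect l₀)
    (isCompact_rect l₀)
  obtain ⟨KG, hKG⟩ := exists_lipschitzOnWith_of_contDiffOn hyp.G_C1 (convex_rect l₀)
    (isCompact_rect l₀)
  obtain ⟨CF, hCF⟩ := (isCompact_rect l₀).exists_bound_of_continuousOn hFC.continuousOn
  obtain ⟨CG, hCG⟩ := (isCompact_rect l₀).exists_bound_of_continuousOn hyp.G_C1.continuousOn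
  have hc := clampRect_mem hl₀
  have hCF0 : 0 ≤ CF := (norm_nonneg _).trans (hCF _ (hc 0))
  have hCG0 : 0 ≤ CG := (norm_nonneg _).trans (hCG _ (hc 0))
  set f : ℝ → ℝ × ℝ → ℝ × ℝ := fun r p =>
    (-(clampRect l₀ p).2 / r, (F (clampRect l₀ p) + r ^ 2 * G (clampRect l₀ p)) / r) with hf
  have hT : 0 < T := ha.trans_le haT
  have hfK : ∀ t ∈ Icc a T,
      LipschitzWith (NNReal.mk ((1 + KF + T ^ 2 * KG) / a) (by positivity)) (f t) := by
    intro t ht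
    have ht0 : 0 < t := ha.trans_le ht.1
    refine LipschitzWith.of_dist_le_mul fun p q => ?_
    have hpq := norm_clampRect_sub_le l₀ p q
    have nn := norm_nonneg (p - q)
    have hKF' := hKF.dist_le_mul _ (hc p) _ (hc q)
    have hKG' := hKG.dist_le_mul _ (hc p) _ (hc q)
    rw [Real.dist_eq, dist_eq_norm] at hKF' hKG'
    have ht2 : t ^ 2 ≤ T ^ 2 := pow_le_pow_left₀ ht0.le ht.2 2
    rw [dist_eq_norm, dist_eq_norm, NNReal.coe_mk, div_mul_eq_mul_div, Prod.norm_def]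
    refine max_le ?_ ?_
    · have e : (f t p - f t q).1 = -((clampRect l₀ p - clampRect l₀ q).2) / t := by
        simp [hf]; ring
      rw [e, norm_div, norm_neg, Real.norm_of_nonneg ht0.le]
      have h1 : ‖(clampRect l₀ p - clampRect l₀ q).2‖ ≤ ‖p - q‖ := (norm_snd_le _).trans hpq
      refine div_le_div₀ (by positivity) ?_ ha ht.1
      have : 0 ≤ (KF + T ^ 2 * KG) * ‖p - q‖ := by positivity
      linarith
    · have e : (f t p - f t q).2 = ((F (clampRect l₀ p) - F (clampRect l₀ q)) +
          t ^ 2 * (G (clampRect l₀ p) - G (clampRect l₀ q))) / t := by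
        simp [hf]; ring
      rw [e, norm_div, Real.norm_of_nonneg ht0.le]
      refine div_le_div₀ (by positivity) ?_ ha ht.1
      refine (norm_add_le _ _).trans ?_
      rw [norm_mul (t ^ 2), Real.norm_of_nonneg (sq_nonneg t), Real.norm_eq_abs, Real.norm_eq_abs]
      have h1 : |F (clampRect l₀ p) - F (clampRect l₀ q)| ≤ KF * ‖p - q‖ :=
        hKF'.trans (by gcongr)
      have h2 : |G (clampRect l₀ p) - G (clampRect l₀ q)| ≤ KG * ‖p - q‖ :=
        hKG'.trans (by gcongr)
      have h3 : t ^ 2 * |G (clampRect l₀ p) - G (clampRect l₀ q)| ≤ T ^ 2 * (KG * ‖p - q‖) :=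
        mul_le_mul ht2 h2 (abs_nonneg _) (by positivity)
      nlinarith
  have hfc : ∀ p, ContinuousOn (f · p) (Icc a T) := by
    intro p r hr
    have hr0 : r ≠ 0 := (ha.trans_le hr.1).ne'
    refine ContinuousAt.continuousWithinAt ?_
    simp only [hf]
    fun_prop (disch := assumption)
  have hfb : ∀ t ∈ Icc a T, ∀ p,
      ‖f t p‖ ≤ NNReal.mk ((1 + CF + T ^ 2 * CG) / a) (by positivity) := by
    intro t ht p
    have ht0 : 0 < t := ha.trans_le ht.1
    have ht2 : t ^ 2 ≤ T ^ 2 := pow_le_pow_left₀ ht0.le ht.2 2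
    have hm := (hc p).2
    have h0 : 0 ≤ CF + T ^ 2 * CG := by positivity
    rw [NNReal.coe_mk, Prod.norm_def]
    refine max_le ?_ ?_
    · rw [norm_div, norm_neg, Real.norm_of_nonneg ht0.le, Real.norm_of_nonneg hm.1]
      exact div_le_div₀ (by positivity) (by linarith [hm.2]) ha ht.1
    · rw [norm_div, Real.norm_of_nonneg ht0.le]
      refine div_le_div₀ (by positivity) ?_ ha ht.1
      refine (norm_add_le _ _).trans ?_
      rw [norm_mul (t ^ 2), Real.norm_of_nonneg (sq_nonneg t)]
      have := mul_le_mul ht2 (hCG _ (hc p)) (norm_nonneg _) (by positivity)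
      linarith [hCF _ (hc p)]
  obtain ⟨α, hα0, hα⟩ := exists_solution_of_lipschitz haT hfK hfc hfb p₀
  refine ⟨fun r => (α r).1, fun r => (α r).2, hα0, fun r hr => ⟨?_, ?_⟩⟩
  · exact (hasFDerivAt_fst (p := α r)).comp_hasDerivWithinAt r (hα r hr)
  · exact (hasFDerivAt_snd (p := α r)).comp_hasDerivWithinAt r (hα r hr)

/-- Solutions starting in the rectangle reach `ℓ = 0` at a finite radius. -/
theorem ContinuationHyp.exists_continuation {B₁ G₁ B G : ℝ × ℝ → ℝ} {l₀ : ℝ}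
    (hyp : ContinuationHyp B₁ G₁ B G l₀) {a la va : ℝ} (ha : 0 < a) (hla : 0 < la)
    (hla' : la ≤ l₀) (hva : 0 < va) (hva' : va < 1) :
    ∃ b > a, ∃ l v : ℝ → ℝ, l a = la ∧ v a = va ∧ l b = 0 ∧
      (∀ r ∈ Icc a b, 0 < v r ∧ v r < 1) ∧ (∀ r ∈ Ico a b, 0 < l r) ∧
      ∀ r ∈ Icc a b, HasDerivWithinAt l (-v r / r) (Icc a b) r ∧
        HasDerivWithinAt v ((-B (l r, v r) * v r + r ^ 2 * G (l r, v r)) / r) (Icc a b) r := by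
  have hl₀ : 0 < l₀ := hla.trans_le hla'
  obtain ⟨N, hN⟩ := (isCompact_rect l₀).exists_bound_of_continuousOn hyp.B₁_cont
  have hN0 : 0 ≤ N := (norm_nonneg _).trans (hN _ (clampRect_mem hl₀.le 0))
  obtain ⟨C, hC⟩ := (isCompact_rect l₀).exists_bound_of_continuousOn hyp.G₁_cont
  have hC0 : 0 ≤ C := (norm_nonneg _).trans (hC _ (clampRect_mem hl₀.le 0))
  -- `G₁` may vanish at `v = 1`, so a uniform lower bound is available only away from it.
  obtain ⟨g, hg, hgle⟩ : ∃ g > 0, ∀ p ∈ rect l₀, p.2 ≤ 1 / 2 → g ≤ G₁ p := by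
    have hsub : Icc 0 l₀ ×ˢ Icc 0 (1 / 2 : ℝ) ⊆ rect l₀ :=
      prod_mono_right (Icc_subset_Icc_right (by norm_num))
    obtain ⟨p, hp, hmin⟩ := (isCompact_Icc.prod isCompact_Icc).exists_isMinOn
      ⟨((0 : ℝ), (0 : ℝ)), ⟨le_rfl, hl₀.le⟩, ⟨le_rfl, by norm_num⟩⟩ (hyp.G₁_cont.mono hsub)
    exact ⟨G₁ p, hyp.G₁_pos p (hsub hp) (hp.2.2.trans_lt (by norm_num)),
      fun q hq hq2 => hmin ⟨hq.1, hq.2.1, hq2⟩⟩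
  -- Beyond radius `s` the source `r² G₁` exceeds the damping `B₁ v` by at least `1` whenever `v ≤
  -- 1/2`.
  obtain ⟨s, hsa, hsg⟩ : ∃ s ≥ a, N + 1 ≤ s ^ 2 * g := by
    refine ⟨a + 1 + (N + 1) / g, by have : 0 ≤ (N + 1) / g := by positivity
                                    linarith, ?_⟩
    have h1 : (N + 1) / g ≤ (a + 1 + (N + 1) / g) ^ 2 := by
      have : 0 ≤ (N + 1) / g := by positivity
      nlinarith
    rwa [div_le_iff₀ hg] at h1
  have hs : 0 < s := ha.trans_le hsa
  -- Small enough that `θ (N + 1/2) ≤ 1/4`, so the decrease of `ℓ` wins where `v > 1/2`.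
  set θ := 1 / (4 * (N + 1)) with hθ
  have hθ0 : 0 < θ := by positivity
  have hθN : θ * (N + 1) = 1 / 4 := by rw [hθ]; field_simp
  -- Chosen so that `(θ/2) log (T/s) = l₀ + θ + 1`, more than the quantity `ℓ - θ v` can lose while
  -- `0 ≤ ℓ ≤ l₀` and `0 ≤ v ≤ 1`.
  set T := s * Real.exp ((l₀ + θ + 1) / (θ / 2)) with hT
  have hsT : s ≤ T := le_mul_of_one_le_right hs.le (Real.one_le_exp (by positivity))
  have haT : a ≤ T := hsa.trans hsT
  obtain ⟨l, v, hlv, hode⟩ := hyp.exists_clamped_solution hl₀.le ha haT (la, va)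
  obtain ⟨hla_eq, hva_eq⟩ := Prod.ext_iff.1 hlv
  simp only at hla_eq hva_eq
  have hlc : ContinuousOn l (Icc a T) := fun r hr => (hode r hr).1.continuousWithinAt
  have hvc : ContinuousOn v (Icc a T) := fun r hr => (hode r hr).2.continuousWithinAt
  have hcl := clampRect_mem (l₀ := l₀) hl₀.le
  have hld : ∀ r ∈ Ioo a T, HasDerivAt l _ r := fun r hr =>
    (hode r (Ioo_subset_Icc_self hr)).1.hasDerivAt (Icc_mem_nhds hr.1 hr.2)
  have hvd : ∀ r ∈ Ioo a T, HasDerivAt v _ r := fun r hr =>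
    (hode r (Ioo_subset_Icc_self hr)).2.hasDerivAt (Icc_mem_nhds hr.1 hr.2)
  have hT0 : 0 < T := ha.trans_le haT
  -- The source is nonnegative and the damping is at most proportional to `v`, so `v` cannot reach
  -- `0`.
  have hvpos : ∀ r ∈ Icc a T, 0 < v r := by
    refine pos_of_deriv_ge (N := N / a) (by positivity) hvc hvd (fun r hr => ?_)
      (by rw [hva_eq]; exact hva)
    have hr0 : 0 < r := ha.trans hr.1
    set p := clampRect l₀ (l r, v r) with hp
    have hpm : p ∈ rect l₀ := hcl _
    have h1 : p.2 ≤ max (v r) 0 := by rw [max_comm]; exact clamp_le_max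
    have hB := abs_le.1 (hN p hpm)
    have hG := hyp.G₁_nonneg p hpm
    have h01 := hpm.2
    rw [hyp.B_eq, hyp.G_eq, le_div_iff₀ hr0]
    have hm : 0 ≤ max (v r) 0 := le_max_right _ _
    have hra : 1 ≤ r / a := by rw [le_div_iff₀ ha]; linarith [hr.1]
    have e1 : -(N / a * max (v r) 0) * r = -(N * max (v r) 0) * (r / a) := by ring
    have e2 : N * max (v r) 0 ≤ N * max (v r) 0 * (r / a) :=
      le_mul_of_one_le_right (by positivity) hra
    have e3 : 0 ≤ r ^ 2 * ((1 - p.2) * G₁ p) :=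
      mul_nonneg (by positivity) (mul_nonneg (by linarith [h01.2]) hG)
    have e4 : (1 - p.2) * B₁ p * p.2 ≤ N * max (v r) 0 := by
      have : (1 - p.2) * B₁ p ≤ N := by nlinarith [h01.1, h01.2, hB.1, hB.2]
      exact mul_le_mul this h1 h01.1 hN0
    linarith
  -- The whole right-hand side of the equation for `v` has the factor `1 - v` (truncated), so `1 -
  -- v` decays at most exponentially on a bounded interval.
  have hvlt : ∀ r ∈ Icc a T, 0 < 1 - v r := by
    refine pos_of_deriv_ge (N := (N + T ^ 2 * C) / a) (by positivity)
      (continuousOn_const.sub hvc) (fun r hr => (hvd r hr).const_sub 1) (fun r hr => ?_)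
      (by rw [hva_eq]; linarith)
    have hr0 : 0 < r := ha.trans hr.1
    set p := clampRect l₀ (l r, v r) with hp
    have hpm : p ∈ rect l₀ := hcl _
    have h1 : 1 - p.2 ≤ max (1 - v r) 0 := by
      have : p.2 = clamp 0 1 (v r) := rfl
      rw [this]
      unfold clamp
      grind
    have hB := abs_le.1 (hN p hpm)
    have hG := hyp.G₁_nonneg p hpm
    have hG' := (le_abs_self _).trans (hC p hpm)
    have h01 := hpm.2
    rw [hyp.B_eq, hyp.G_eq, neg_le_neg_iff, div_le_iff₀ hr0]
    have hm : 0 ≤ max (1 - v r) 0 := le_max_right _ _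
    have hra : 1 ≤ r / a := by rw [le_div_iff₀ ha]; linarith [hr.1]
    have e0 : 0 ≤ (N + T ^ 2 * C) * max (1 - v r) 0 := by positivity
    have e1 : (N + T ^ 2 * C) / a * max (1 - v r) 0 * r =
      (N + T ^ 2 * C) * max (1 - v r) 0 * (r / a) := by ring
    have e2 := le_mul_of_one_le_right e0 hra
    have e3 : r ^ 2 * G₁ p ≤ T ^ 2 * C :=
      mul_le_mul (pow_le_pow_left₀ hr0.le hr.2.le 2) hG' hG (by positivity)
    have e4 : -(B₁ p * p.2) + r ^ 2 * G₁ p ≤ N + T ^ 2 * C := by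
      nlinarith [h01.1, h01.2, hB.1, hB.2]
    have e5 : (1 - p.2) * (-(B₁ p * p.2) + r ^ 2 * G₁ p) ≤
        max (1 - v r) 0 * (N + T ^ 2 * C) :=
      (mul_le_mul_of_nonneg_left e4 (by linarith [h01.2])).trans
        (mul_le_mul_of_nonneg_right h1 (by positivity))
    rw [e1]
    linarith
  have hanti : AntitoneOn l (Icc a T) := by
    refine antitoneOn_of_hasDerivWithinAt_nonpos (convex_Icc a T) hlc
      (fun r hr => (hld r (by rwa [interior_Icc] at hr)).hasDerivWithinAt) (fun r hr => ?_)
    rw [interior_Icc] at hr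
    have := (hcl (l r, v r)).2.1
    exact div_nonpos_of_nonpos_of_nonneg (by linarith) (ha.trans hr.1).le
  have hlle : ∀ r ∈ Icc a T, l r ≤ l₀ := fun r hr =>
    (hanti ⟨le_rfl, haT⟩ hr hr.1).trans (hla_eq.le.trans hla')
  have hmem : ∀ r ∈ Icc a T, 0 ≤ l r → (l r, v r) ∈ rect l₀ := fun r hr h0 =>
    ⟨⟨h0, hlle r hr⟩, (hvpos r hr).le, by linarith [hvlt r hr]⟩
  obtain ⟨t, ht, hlt⟩ : ∃ t ∈ Icc a T, l t ≤ 0 := by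
    by_contra! hpos
    -- The Lyapunov function combines two mechanisms: for `v > 1/2` the term `-v` drives `ℓ` down,
    -- and for `v ≤ 1/2` the source makes `r v' ≥ 1/2`. In both cases the rate is enough to absorb
    -- the logarithm.
    have hΨ : AntitoneOn (fun r => l r - θ * v r + θ / 2 * Real.log r) (Icc s T) := by
      have hss : Icc s T ⊆ Icc a T := Icc_subset_Icc_left hsa
      refine antitoneOn_of_hasDerivWithinAt_nonpos (f' := fun r => -v r / r -
          θ * ((-B (l r, v r) * v r + r ^ 2 * G (l r, v r)) / r) + θ / 2 * r⁻¹)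
        (convex_Icc s T) ?_ (fun r hr => ?_) (fun r hr => ?_)
      · refine ((hlc.mono hss).sub (continuousOn_const.mul (hvc.mono hss))).add
          (continuousOn_const.mul (Real.continuousOn_log.mono fun r hr => ?_))
        exact (hs.trans_le hr.1).ne'
      · rw [interior_Icc] at hr
        have hr' : r ∈ Ioo a T := ⟨hsa.trans_lt hr.1, hr.2⟩
        have hp := clampRect_of_mem (hmem r (Ioo_subset_Icc_self hr')
          (hpos r (Ioo_subset_Icc_self hr')).le)
        have h1 := hld r hr'
        have h2 := hvd r hr'
        rw [hp] at h1 h2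
        exact ((h1.sub (h2.const_mul θ)).add ((Real.hasDerivAt_log
          (hs.trans hr.1).ne').const_mul (θ / 2))).hasDerivWithinAt
      · rw [interior_Icc] at hr
        have hr' : r ∈ Icc a T := ⟨hsa.trans hr.1.le, hr.2.le⟩
        have hr0 : 0 < r := hs.trans hr.1
        have hm := hmem r hr' (hpos r hr').le
        have hB := abs_le.1 (hN _ hm)
        have hG := hyp.G₁_nonneg _ hm
        have hv0 := hvpos r hr'
        have hv1 := hvlt r hr'
        have e : -v r / r - θ * ((-B (l r, v r) * v r + r ^ 2 * G (l r, v r)) / r) + θ / 2 * r⁻¹ =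
            (-v r - θ * ((1 - v r) * (-(B₁ (l r, v r) * v r) + r ^ 2 * G₁ (l r, v r))) + θ / 2)
              / r := by
          rw [hyp.B_eq, hyp.G_eq]
          field_simp
        rw [e]
        refine div_nonpos_of_nonpos_of_nonneg ?_ hr0.le
        have hBv : B₁ (l r, v r) * v r ≤ N := by nlinarith [hB.1, hB.2]
        rcases le_or_gt (v r) (1 / 2) with hv | hv
        · have h1 : s ^ 2 * g ≤ r ^ 2 * G₁ (l r, v r) :=
            mul_le_mul (pow_le_pow_left₀ hs.le hr.1.le 2) (hgle _ hm hv) hg.le (by positivity)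
          have h2 : 1 / 2 * 1 ≤ (1 - v r) * (-(B₁ (l r, v r) * v r) + r ^ 2 * G₁ (l r, v r)) :=
            mul_le_mul (by linarith) (by linarith) (by norm_num) hv1.le
          have h3 := mul_le_mul_of_nonneg_left h2 hθ0.le
          linarith
        · have h1 : 0 ≤ r ^ 2 * G₁ (l r, v r) := by positivity
          have h2 : -N ≤ (1 - v r) * (-(B₁ (l r, v r) * v r) + r ^ 2 * G₁ (l r, v r)) := by
            have : -(N * (1 - v r)) ≤
                (1 - v r) * (-(B₁ (l r, v r) * v r) + r ^ 2 * G₁ (l r, v r)) := by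
              have := mul_le_mul_of_nonneg_left
                (show -N ≤ -(B₁ (l r, v r) * v r) + r ^ 2 * G₁ (l r, v r) by linarith) hv1.le
              linarith
            have : N * (1 - v r) ≤ N := mul_le_of_le_one_right hN0 (by linarith)
            linarith
          have h3 := mul_le_mul_of_nonneg_left h2 hθ0.le
          nlinarith
    have h := hΨ ⟨le_rfl, hsT⟩ ⟨hsT, le_rfl⟩ hsT
    have hlog : Real.log T = Real.log s + (l₀ + θ + 1) / (θ / 2) := by
      rw [hT, Real.log_mul hs.ne' (Real.exp_ne_zero _), Real.log_exp]
    simp only [hlog] at h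
    have e : θ / 2 * (Real.log s + (l₀ + θ + 1) / (θ / 2)) =
        θ / 2 * Real.log s + (l₀ + θ + 1) := by
      field_simp
    rw [e] at h
    have h1 := hpos T ⟨haT, le_rfl⟩
    have h2 := hlle s ⟨hsa, hsT⟩
    have h3 := mul_pos hθ0 (hvpos s ⟨hsa, hsT⟩)
    have h4 := mul_pos hθ0 (hvlt T ⟨haT, le_rfl⟩)
    linarith
  obtain ⟨b, hb, hb0, hbpos⟩ := exists_first_zero ht.1 (hlc.mono (Icc_subset_Icc_right ht.2))
    (by rw [hla_eq]; exact hla) hlt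
  have hbT : Icc a b ⊆ Icc a T := Icc_subset_Icc_right (hb.2.trans ht.2)
  refine ⟨b, hb.1, l, v, hla_eq, hva_eq, hb0,
    fun r hr => ⟨hvpos r (hbT hr), by linarith [hvlt r (hbT hr)]⟩, hbpos, fun r hr => ?_⟩
  have hl0 : 0 ≤ l r := by
    rcases hr.2.eq_or_lt with rfl | h
    · exact hb0.ge
    · exact (hbpos r ⟨hr.1, h⟩).le
  obtain ⟨h1, h2⟩ := hode r (hbT hr)
  rw [clampRect_of_mem (hmem r (hbT hr) hl0)] at h1 h2
  exact ⟨h1.mono hbT, h2.mono hbT⟩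

/-- Used to glue the solution near the center to its continuation: both pieces obey the same
equation at the joint, so the one-sided derivatives agree. -/
theorem hasDerivAt_ite_le {f g : ℝ → ℝ} {a d : ℝ} (hf : HasDerivAt f d a)
    (hg : HasDerivWithinAt g d (Ici a) a) (h : f a = g a) :
    HasDerivAt (fun r => if r ≤ a then f r else g r) d a := by
  have h1 : HasDerivWithinAt (fun r => if r ≤ a then f r else g r) d (Iic a) a :=
    hf.hasDerivWithinAt.congr (fun r (hr : r ≤ a) => if_pos hr) (if_pos le_rfl)
  have h2 : HasDerivWithinAt (fun r => if r ≤ a then f r else g r) d (Ici a) a := by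
    refine hg.congr (fun r (hr : a ≤ r) => ?_) ((if_pos le_rfl).trans h)
    rcases hr.eq_or_lt with rfl | hr
    · exact (if_pos le_rfl).trans h
    · exact if_neg (not_le.2 hr)
  simpa using h1.union h2

/-- Global solution of the structure equations with regular center. -/
theorem ContinuationHyp.exists_global_solution {B₁ G₁ B G : ℝ × ℝ → ℝ} {l₀ : ℝ}
    (hyp : ContinuationHyp B₁ G₁ B G l₀) (hl₀ : 0 < l₀) (hB : ContDiffAt ℝ 1 B (l₀, 0))
    (hG : ContDiffAt ℝ 1 G (l₀, 0)) (hB0 : 0 < B (l₀, 0)) (hG0 : 0 < G (l₀, 0)) :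
    ∃ b > 0, ∃ l v : ℝ → ℝ, ContinuousOn l (Icc 0 b) ∧ ContinuousOn v (Icc 0 b) ∧
      l 0 = l₀ ∧ v 0 = 0 ∧ l b = 0 ∧ (∀ r ∈ Ioo 0 b, SolvesAt B G l v r) ∧
      (∀ r ∈ Ioc 0 b, 0 < v r ∧ v r < 1) ∧ ∀ r ∈ Ioo 0 b, 0 < l r ∧ l r < l₀ := by
  obtain ⟨h, hh, l₁, v₁, hl₁c, hv₁c, hl₁0, hv₁0, hsol⟩ := exists_local_solution hB hG hB0 hG0
  have hev : ∀ᶠ r in 𝓝 (0 : ℝ), 0 < l₁ r ∧ v₁ r < 1 :=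
    (hl₁c.continuousAt.eventually (lt_mem_nhds (by rw [hl₁0]; exact hl₀))).and
      (hv₁c.continuousAt.eventually (gt_mem_nhds (by rw [hv₁0]; exact one_pos)))
  obtain ⟨η, hη, hball⟩ := Metric.eventually_nhds_iff.1 hev
  obtain ⟨a, ha, hah, haη⟩ : ∃ a > 0, a < h ∧ a < η :=
    ⟨min h η / 2, by positivity, by have := min_le_left h η; have : 0 < min h η := by positivity
                                    linarith,
      by have := min_le_right h η; have : 0 < min h η := by positivity
         linarith⟩
  have hreg : ∀ r ∈ Ioc 0 a, SolvesAt B G l₁ v₁ r ∧ 0 < v₁ r ∧ 0 < l₁ r ∧ v₁ r < 1 := by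
    intro r hr
    obtain ⟨h1, h2⟩ := hsol r ⟨hr.1, hr.2.trans_lt hah⟩
    refine ⟨h1, h2, hball ?_⟩
    rw [Real.dist_eq, sub_zero, abs_of_pos hr.1]
    exact hr.2.trans_lt haη
  have hstrict : StrictAntiOn l₁ (Icc 0 a) := by
    refine strictAntiOn_of_hasDerivWithinAt_neg (f' := fun r => -v₁ r / r) (convex_Icc 0 a)
      hl₁c.continuousOn (fun r hr => ?_) (fun r hr => ?_)
    · rw [interior_Icc] at hr
      exact (hreg r (Ioo_subset_Ioc_self hr)).1.1.hasDerivWithinAt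
    · rw [interior_Icc] at hr
      exact div_neg_of_neg_of_pos (by linarith [(hreg r (Ioo_subset_Ioc_self hr)).2.1]) hr.1
  have hl₁lt : ∀ r ∈ Ioc 0 a, l₁ r < l₀ := fun r hr => by
    rw [← hl₁0]
    exact hstrict ⟨le_rfl, ha.le⟩ ⟨hr.1.le, hr.2⟩ hr.1
  have haa : a ∈ Ioc 0 a := ⟨ha, le_rfl⟩
  obtain ⟨b, hb, l₂, v₂, hl₂a, hv₂a, hl₂b, hv₂, hl₂pos, hode⟩ := hyp.exists_continuation ha
    (hreg a haa).2.2.1 (hl₁lt a haa).le (hreg a haa).2.1 (hreg a haa).2.2.2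
  set l : ℝ → ℝ := fun r => if r ≤ a then l₁ r else l₂ r with hl
  set v : ℝ → ℝ := fun r => if r ≤ a then v₁ r else v₂ r with hv
  have hlle : ∀ r ≤ a, l r = l₁ r := fun r hr => if_pos hr
  have hvle : ∀ r ≤ a, v r = v₁ r := fun r hr => if_pos hr
  have hlge : ∀ r, a ≤ r → l r = l₂ r := fun r hr => by
    rcases hr.eq_or_lt with rfl | hr
    · rw [hlle _ le_rfl, hl₂a]
    · exact if_neg (not_le.2 hr)
  have hvge : ∀ r, a ≤ r → v r = v₂ r := fun r hr => by
    rcases hr.eq_or_lt with rfl | hr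
    · rw [hvle _ le_rfl, hv₂a]
    · exact if_neg (not_le.2 hr)
  have hcont : ∀ {f f₁ f₂ : ℝ → ℝ}, Continuous f₁ → ContinuousOn f₂ (Icc a b) →
      (∀ r ≤ a, f r = f₁ r) → (∀ r, a ≤ r → f r = f₂ r) → ContinuousOn f (Icc 0 b) := by
    intro f f₁ f₂ h₁ h₂ e₁ e₂
    have : Icc 0 b = Icc 0 a ∪ Icc a b := (Icc_union_Icc_eq_Icc ha.le hb.le).symm
    rw [this]
    exact (h₁.continuousOn.congr fun r hr => e₁ r hr.2).union_of_isClosed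
      (h₂.congr fun r hr => e₂ r hr.1) isClosed_Icc isClosed_Icc
  have hsolves : ∀ r ∈ Ioo 0 b, SolvesAt B G l v r := by
    intro r hr
    rcases lt_trichotomy r a with hra | rfl | hra
    · obtain ⟨h1, h2⟩ := (hreg r ⟨hr.1, hra.le⟩).1
      have e1 : l =ᶠ[𝓝 r] l₁ := by filter_upwards [gt_mem_nhds hra] with t ht using hlle t ht.le
      have e2 : v =ᶠ[𝓝 r] v₁ := by filter_upwards [gt_mem_nhds hra] with t ht using hvle t ht.le
      rw [SolvesAt, hlle r hra.le, hvle r hra.le]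
      exact ⟨h1.congr_of_eventuallyEq e1, h2.congr_of_eventuallyEq e2⟩
    · obtain ⟨h1, h2⟩ := (hreg r haa).1
      obtain ⟨h3, h4⟩ := hode r ⟨le_rfl, hb.le⟩
      have hn : Icc r b ∈ 𝓝[≥] r := Icc_mem_nhdsGE hb
      rw [hv₂a] at h3
      rw [hl₂a, hv₂a] at h4
      rw [SolvesAt, hlle r le_rfl, hvle r le_rfl]
      exact ⟨hasDerivAt_ite_le h1 (h3.mono_of_mem_nhdsWithin hn) hl₂a.symm,
        hasDerivAt_ite_le h2 (h4.mono_of_mem_nhdsWithin hn) hv₂a.symm⟩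
    · obtain ⟨h1, h2⟩ := hode r ⟨hra.le, hr.2.le⟩
      have hn : Icc a b ∈ 𝓝 r := Icc_mem_nhds hra hr.2
      have e1 : l =ᶠ[𝓝 r] l₂ := by filter_upwards [lt_mem_nhds hra] with t ht using hlge t ht.le
      have e2 : v =ᶠ[𝓝 r] v₂ := by filter_upwards [lt_mem_nhds hra] with t ht using hvge t ht.le
      rw [SolvesAt, hlge r hra.le, hvge r hra.le]
      exact ⟨(h1.hasDerivAt hn).congr_of_eventuallyEq e1,
        (h2.hasDerivAt hn).congr_of_eventuallyEq e2⟩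
  have hlc : ContinuousOn l (Icc 0 b) :=
    hcont hl₁c (fun r hr => (hode r hr).1.continuousWithinAt) hlle hlge
  have hvbd : ∀ r ∈ Ioc 0 b, 0 < v r ∧ v r < 1 := by
    intro r hr
    rcases le_total r a with hra | hra
    · rw [hvle r hra]
      exact ⟨(hreg r ⟨hr.1, hra⟩).2.1, (hreg r ⟨hr.1, hra⟩).2.2.2⟩
    · rw [hvge r hra]
      exact hv₂ r ⟨hra, hr.2⟩
  have hl0 : l 0 = l₀ := (hlle 0 ha.le).trans hl₁0
  refine ⟨b, ha.trans hb, l, v, hlc,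
    hcont hv₁c (fun r hr => (hode r hr).2.continuousWithinAt) hvle hvge,
    hl0, (hvle 0 ha.le).trans hv₁0, (hlge b hb.le).trans hl₂b, hsolves, hvbd,
    fun r hr => ⟨?_, ?_⟩⟩
  · rcases lt_or_ge r a with hra | hra
    · rw [hlle r hra.le]
      exact (hreg r ⟨hr.1, hra.le⟩).2.2.1
    · rw [hlge r hra]
      exact hl₂pos r ⟨hra, hr.2⟩
  · rw [← hl0]
    refine strictAntiOn_of_hasDerivWithinAt_neg (f' := fun r => -v r / r) (convex_Icc 0 b)
      hlc (fun r hr => ?_) (fun r hr => ?_) ⟨le_rfl, (ha.trans hb).le⟩ (Ioo_subset_Icc_self hr) hr.1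
    · rw [interior_Icc] at hr
      exact (hsolves r hr).1.hasDerivWithinAt
    · rw [interior_Icc] at hr
      exact div_neg_of_neg_of_pos (by linarith [(hvbd r (Ioo_subset_Ioc_self hr)).1]) hr.1

/-! ### Uniqueness with a regular center -/

/-- A solution with regular center satisfies `v = O(r²)` and `ℓ - l₀ = O(r²)`. -/
theorem TameOn.center_bounds {B G : ℝ × ℝ → ℝ} {M L h l₀ : ℝ} {s : Set (ℝ × ℝ)}
    (ht : TameOn B G M L s) (hM : 0 < M) {l v : ℝ → ℝ} (hl : ContinuousOn l (Icc 0 h))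
    (hv : ContinuousOn v (Icc 0 h)) (hl0 : l 0 = l₀) (hv0 : v 0 = 0)
    (hmem : ∀ r ∈ Ioo 0 h, (l r, v r) ∈ s) (hsol : ∀ r ∈ Ioo 0 h, SolvesAt B G l v r) :
    ∀ r ∈ Icc 0 h, 0 ≤ v r ∧ v r ≤ M * r ^ 2 ∧ |l r - l₀| ≤ M * r ^ 2 := by
  have hsq : ∀ r : ℝ, HasDerivAt (fun r : ℝ => M * r ^ 2) (M * (2 * r)) r := fun r => by
    simpa using (hasDerivAt_pow 2 r).const_mul M
  -- Where `-v > 0`, both the damping and the source push `v` upward, so `-v` cannot become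
  -- positive.
  have v1 : ∀ r ∈ Icc 0 h, -v r ≤ 0 := by
    refine nonpos_of_deriv_nonpos_of_pos hv.neg (fun r hr => (hsol r hr).2.neg)
      (fun r hr hpos => ?_) (by simp [hv0])
    have h1 := ht.B_nonneg _ (hmem r hr)
    have h2 := ht.G_nonneg _ (hmem r hr)
    have h3 : 0 ≤ B (l r, v r) * -v r := mul_nonneg h1 hpos.le
    have h4 : 0 ≤ r ^ 2 * G (l r, v r) := by positivity
    exact neg_nonpos.2 (div_nonneg (by linarith) hr.1.le)
  have v2 : ∀ r ∈ Icc 0 h, v r - M * r ^ 2 ≤ 0 := by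
    refine nonpos_of_deriv_nonpos_of_pos (hv.sub (by fun_prop))
      (fun r hr => (hsol r hr).2.sub (hsq r)) (fun r hr hpos => ?_) (by simp [hv0])
    have h1 := ht.B_nonneg _ (hmem r hr)
    have h2 := ht.G_le _ (hmem r hr)
    have h3 : 0 ≤ B (l r, v r) * v r := mul_nonneg h1 (by nlinarith [sq_nonneg r])
    have h4 : r ^ 2 * G (l r, v r) ≤ r ^ 2 * M := by gcongr
    rw [sub_nonpos, div_le_iff₀ hr.1]
    nlinarith [sq_nonneg r]
  have l1 : ∀ r ∈ Icc 0 h, l r - l₀ ≤ 0 := by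
    refine nonpos_of_deriv_nonpos_of_pos (hl.sub continuousOn_const)
      (fun r hr => (hsol r hr).1.sub_const l₀) (fun r hr _ => ?_) (by simp [hl0])
    exact div_nonpos_of_nonpos_of_nonneg (v1 r (Ioo_subset_Icc_self hr)) hr.1.le
  have l2 : ∀ r ∈ Icc 0 h, l₀ - l r - M * r ^ 2 ≤ 0 := by
    refine nonpos_of_deriv_nonpos_of_pos ((continuousOn_const.sub hl).sub (by fun_prop))
      (fun r hr => ((hsol r hr).1.const_sub l₀).sub (hsq r)) (fun r hr _ => ?_) (by simp [hl0])
    have := v2 r (Ioo_subset_Icc_self hr)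
    rw [neg_div, neg_neg, sub_nonpos, div_le_iff₀ hr.1]
    nlinarith [sq_nonneg r]
  intro r hr
  have h1 := v1 r hr
  have h2 := v2 r hr
  have h3 := l1 r hr
  have h4 := l2 r hr
  refine ⟨by linarith, by linarith, abs_le.2 ⟨by linarith, ?_⟩⟩
  have : 0 ≤ M * r ^ 2 := by positivity
  linarith

/-- The differential inequality for the energy `p² + u²` of the difference of two solutions. -/
theorem energy_inequality {β L M r b₁ b₂ g₁ g₂ v₁ v₂ k d p u p' u' : ℝ} (hβ : 0 < β) (hL : 0 < L)
    (hM : 0 < M) (hr : 0 < r) (hr1 : r ≤ 1) (hb₁ : 0 ≤ b₁) (hv₂ : 0 ≤ v₂) (hv₂' : v₂ ≤ M * r ^ 2)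
    (hk : |k| ≤ d) (hu : |v₁ - v₂| ≤ d) (hd : d ≤ max |k| |v₁ - v₂|)
    (hB : |b₁ - b₂| ≤ L * d) (hG : |g₁ - g₂| ≤ L * d) (hBβ : |b₁ - β| ≤ L * (M * r ^ 2))
    (pdef : p = β * k - (v₁ - v₂)) (udef : u = v₁ - v₂)
    (pdef' : p' = β * (-v₁ / r - -v₂ / r) -
      ((-b₁ * v₁ + r ^ 2 * g₁) / r - (-b₂ * v₂ + r ^ 2 * g₂) / r))
    (udef' : u' = (-b₁ * v₁ + r ^ 2 * g₁) / r - (-b₂ * v₂ + r ^ 2 * g₂) / r) :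
    2 * p * p' + 2 * u * u' ≤ 4 * (L * M + L * M + L) * (1 + 1 / β) * (p ^ 2 + u ^ 2) := by
  set C := L * M + L * M + L with hC
  set D := 1 + 1 / β with hD
  have hC0 : 0 < C := by positivity
  have hD0 : 0 < D := by positivity
  have hd0 : 0 ≤ d := (abs_nonneg _).trans hk
  rw [← udef] at hu hd
  have hrr : r ^ 2 ≤ r := by nlinarith
  -- Since `β > 0`, the pair `(p, u)` determines the difference of the solutions through `k = (p +
  -- u) / β`.
  have hdD : d ≤ D * (|p| + |u|) := by
    have e1 : |k| ≤ 1 / β * (|p| + |u|) := by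
      have : k = 1 / β * (p + u) := by
        rw [pdef, udef]; field_simp; ring
      rw [this, abs_mul, abs_of_pos (by positivity)]
      have := abs_add_le p u
      gcongr
    have e3 : D * (|p| + |u|) = (|p| + |u|) + 1 / β * (|p| + |u|) := by
      rw [hD]; ring
    have e4 : 0 ≤ 1 / β * (|p| + |u|) := by positivity
    refine hd.trans (max_le (e1.trans ?_) ?_)
    · linarith [abs_nonneg p, abs_nonneg u]
    · linarith [abs_nonneg p]
  set R := (b₁ - b₂) * v₂ - r ^ 2 * (g₁ - g₂) with hR
  have hR' : |R| ≤ (L * M + L) * d * r ^ 2 := by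
    refine (abs_sub _ _).trans ?_
    rw [abs_mul, abs_mul, abs_of_nonneg hv₂, abs_of_nonneg (sq_nonneg r)]
    have e1 : |b₁ - b₂| * v₂ ≤ L * d * (M * r ^ 2) := mul_le_mul hB hv₂' hv₂ (by positivity)
    have e2 : r ^ 2 * |g₁ - g₂| ≤ r ^ 2 * (L * d) := by gcongr
    linarith
  -- In this combination `b₁` enters only through `b₁ - β = O(r²)`. As `R` is also `O(r²)` relative
  -- to `d`, the division by `r` is harmless.
  have ep : p' = ((b₁ - β) * u + R) / r := by
    rw [pdef', hR, udef]; field_simp; ring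
  have eu : u' = (-b₁ * u - R) / r := by
    rw [udef', hR, udef]; field_simp; ring
  have kp : p * p' ≤ C * d * |p| := by
    have e1 : |(b₁ - β) * u + R| ≤ C * d * r := by
      refine (abs_add_le _ _).trans ?_
      rw [abs_mul]
      have e2 : |b₁ - β| * |u| ≤ L * (M * r ^ 2) * d := mul_le_mul hBβ hu (abs_nonneg _)
        (by positivity)
      have e4 : C * d * r ^ 2 ≤ C * d * r := by gcongr
      rw [hC] at e4 ⊢
      linarith
    rw [ep, mul_div_assoc', div_le_iff₀ hr]
    refine (le_abs_self _).trans ?_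
    rw [abs_mul]
    have := mul_le_mul_of_nonneg_left e1 (abs_nonneg p)
    linarith
  -- The singular term `-b₁ u² / r` is not small, but it has the good sign and is dropped.
  have ku : u * u' ≤ C * d * |u| := by
    rw [eu, mul_div_assoc', div_le_iff₀ hr]
    have e1 : u * (-b₁ * u - R) ≤ |u| * |R| := by
      have h1 := neg_le_of_abs_le (abs_mul u R).le
      have h2 := mul_nonneg hb₁ (sq_nonneg u)
      linarith
    have e4 : |R| ≤ C * d * r := by
      have e5 : (L * M + L) * d * r ^ 2 ≤ (L * M + L) * d * r := by gcongr
      have e6 : 0 ≤ L * M * d * r := by positivity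
      rw [hC]
      linarith
    have := mul_le_mul_of_nonneg_left e4 (abs_nonneg u)
    linarith
  have e1 : C * d * (|p| + |u|) ≤ C * (D * (|p| + |u|)) * (|p| + |u|) := by gcongr
  have e2 : (|p| + |u|) ^ 2 ≤ 2 * (p ^ 2 + u ^ 2) := by
    nlinarith [sq_abs p, sq_abs u, sq_nonneg (|p| - |u|)]
  have e3 := mul_le_mul_of_nonneg_left e2 (show 0 ≤ C * D by positivity)
  linarith

/-- Uniqueness near the center. -/
theorem TameOn.eq_of_solvesAt {B G : ℝ × ℝ → ℝ} {M L h l₀ : ℝ} {s : Set (ℝ × ℝ)}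
    (ht : TameOn B G M L s) (hM : 0 < M) (hL : 0 < L) (h0 : (l₀, (0 : ℝ)) ∈ s)
    (hβ : 0 < B (l₀, 0)) (hh1 : h ≤ 1) {l₁ v₁ l₂ v₂ : ℝ → ℝ}
    (hl₁ : ContinuousOn l₁ (Icc 0 h)) (hv₁ : ContinuousOn v₁ (Icc 0 h)) (hl₁0 : l₁ 0 = l₀)
    (hv₁0 : v₁ 0 = 0) (hm₁ : ∀ r ∈ Ioo 0 h, (l₁ r, v₁ r) ∈ s)
    (hs₁ : ∀ r ∈ Ioo 0 h, SolvesAt B G l₁ v₁ r)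
    (hl₂ : ContinuousOn l₂ (Icc 0 h)) (hv₂ : ContinuousOn v₂ (Icc 0 h)) (hl₂0 : l₂ 0 = l₀)
    (hv₂0 : v₂ 0 = 0) (hm₂ : ∀ r ∈ Ioo 0 h, (l₂ r, v₂ r) ∈ s)
    (hs₂ : ∀ r ∈ Ioo 0 h, SolvesAt B G l₂ v₂ r) :
    ∀ r ∈ Icc 0 h, l₁ r = l₂ r ∧ v₁ r = v₂ r := by
  have b₁ := ht.center_bounds hM hl₁ hv₁ hl₁0 hv₁0 hm₁ hs₁
  have b₂ := ht.center_bounds hM hl₂ hv₂ hl₂0 hv₂0 hm₂ hs₂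
  generalize hβdef : B (l₀, 0) = β at hβ
  obtain ⟨N, hN⟩ : ∃ N, N = 4 * (L * M + L * M + L) * (1 + 1 / β) := ⟨_, rfl⟩
  obtain ⟨p, hp⟩ : ∃ p : ℝ → ℝ, p = fun r => β * (l₁ r - l₂ r) - (v₁ r - v₂ r) := ⟨_, rfl⟩
  obtain ⟨u, hu⟩ : ∃ u : ℝ → ℝ, u = fun r => v₁ r - v₂ r := ⟨_, rfl⟩
  have key : ∀ r ∈ Icc 0 h, (p r ^ 2 + u r ^ 2) * Real.exp (-(N * r)) ≤ 0 := by
    have hpc : ContinuousOn p (Icc 0 h) := by rw [hp]; fun_prop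
    have huc : ContinuousOn u (Icc 0 h) := by rw [hu]; fun_prop
    obtain ⟨p', hp'⟩ : ∃ p' : ℝ → ℝ, p' = fun r => β * (-v₁ r / r - -v₂ r / r) -
      ((-B (l₁ r, v₁ r) * v₁ r + r ^ 2 * G (l₁ r, v₁ r)) / r -
        (-B (l₂ r, v₂ r) * v₂ r + r ^ 2 * G (l₂ r, v₂ r)) / r) := ⟨_, rfl⟩
    obtain ⟨u', hu'⟩ : ∃ u' : ℝ → ℝ, u' = fun r =>
      (-B (l₁ r, v₁ r) * v₁ r + r ^ 2 * G (l₁ r, v₁ r)) / r -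
        (-B (l₂ r, v₂ r) * v₂ r + r ^ 2 * G (l₂ r, v₂ r)) / r := ⟨_, rfl⟩
    have hpd : ∀ r ∈ Ioo 0 h, HasDerivAt p (p' r) r := fun r hr => by
      rw [hp, hp']
      exact (((hs₁ r hr).1.sub (hs₂ r hr).1).const_mul β).sub ((hs₁ r hr).2.sub (hs₂ r hr).2)
    have hud : ∀ r ∈ Ioo 0 h, HasDerivAt u (u' r) r := fun r hr => by
      rw [hu, hu']
      exact (hs₁ r hr).2.sub (hs₂ r hr).2
    have hexp : ∀ r : ℝ, HasDerivAt (fun r => Real.exp (-(N * r)))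
        (Real.exp (-(N * r)) * -(N * 1)) r := fun r =>
      (((hasDerivAt_id r).const_mul N).neg).exp
    refine nonpos_of_deriv_nonpos_of_pos
      (f' := fun r => (2 * p r * p' r + 2 * u r * u' r) * Real.exp (-(N * r)) +
        (p r ^ 2 + u r ^ 2) * (Real.exp (-(N * r)) * -(N * 1))) (by fun_prop)
      (fun r hr => ?_) (fun r hr _ => ?_) (by simp [hp, hu, hl₁0, hl₂0, hv₁0, hv₂0])
    · refine HasDerivAt.mul ?_ (hexp r)
      have := ((hpd r hr).fun_pow 2).fun_add ((hud r hr).fun_pow 2)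
      simpa using this
    · have hr' := Ioo_subset_Icc_self hr
      obtain ⟨v10, v1M, l1M⟩ := b₁ r hr'
      obtain ⟨v20, v2M, -⟩ := b₂ r hr'
      have hB1 : |B (l₁ r, v₁ r) - β| ≤ L * (M * r ^ 2) := by
        rw [← hβdef]
        refine (ht.B_lip _ (hm₁ r hr) _ h0).trans (mul_le_mul_of_nonneg_left ?_ hL.le)
        refine max_le l1M ?_
        change |v₁ r - 0| ≤ _
        rw [sub_zero, abs_of_nonneg v10]
        exact v1M
      have fin := energy_inequality (k := l₁ r - l₂ r) hβ hL hM hr.1 (hr.2.le.trans hh1)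
        (ht.B_nonneg _ (hm₁ r hr)) v20 v2M (norm_fst_le ((l₁ r, v₁ r) - (l₂ r, v₂ r)))
        (norm_snd_le ((l₁ r, v₁ r) - (l₂ r, v₂ r))) le_rfl (ht.B_lip _ (hm₁ r hr) _ (hm₂ r hr))
        (ht.G_lip _ (hm₁ r hr) _ (hm₂ r hr)) hB1 (congrFun hp r) (congrFun hu r)
        (congrFun hp' r) (congrFun hu' r)
      rw [← hN] at fin
      have := mul_le_mul_of_nonneg_right fin (Real.exp_pos (-(N * r))).le
      linarith
  intro r hr
  have h1 : p r ^ 2 + u r ^ 2 ≤ 0 := by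
    by_contra! hpos
    exact absurd (key r hr) (not_le.2 (mul_pos hpos (Real.exp_pos _)))
  have hp0 : p r = 0 := by nlinarith [sq_nonneg (p r), sq_nonneg (u r)]
  have hu0 : u r = 0 := by nlinarith [sq_nonneg (p r), sq_nonneg (u r)]
  simp only [hp, hu] at hp0 hu0
  rw [hu0, sub_zero, mul_eq_zero, sub_eq_zero] at hp0
  exact ⟨hp0.resolve_left hβ.ne', sub_eq_zero.1 hu0⟩

/-- Local uniqueness away from the center. -/
theorem eventuallyEq_of_solvesAt {B G : ℝ × ℝ → ℝ} {l₁ v₁ l₂ v₂ : ℝ → ℝ} {t : ℝ} (ht : 0 < t)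
    (hB : ContDiffAt ℝ 1 B (l₁ t, v₁ t)) (hG : ContDiffAt ℝ 1 G (l₁ t, v₁ t))
    (h₁ : ∀ᶠ r in 𝓝 t, SolvesAt B G l₁ v₁ r) (h₂ : ∀ᶠ r in 𝓝 t, SolvesAt B G l₂ v₂ r)
    (hl : l₁ t = l₂ t) (hv : v₁ t = v₂ t) : ∀ᶠ r in 𝓝 t, l₁ r = l₂ r ∧ v₁ r = v₂ r := by
  set f : ℝ → ℝ × ℝ → ℝ × ℝ := fun r q => (-q.2 / r, (-B q * q.2 + r ^ 2 * G q) / r) with hf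
  obtain ⟨KF, s₁, hs₁, hKF⟩ :=
    (hB.neg.mul contDiffAt_snd : ContDiffAt ℝ 1 (fun q : ℝ × ℝ => -B q * q.2)
      (l₁ t, v₁ t)).exists_lipschitzOnWith
  obtain ⟨KG, s₂, hs₂, hKG⟩ := hG.exists_lipschitzOnWith
  have hlip : ∀ᶠ r in 𝓝 t, LipschitzOnWith
      (NNReal.mk ((1 + KF + (2 * t) ^ 2 * KG) / (t / 2)) (by positivity)) (f r) (s₁ ∩ s₂) := by
    filter_upwards [Ioo_mem_nhds (show t / 2 < t by linarith) (show t < 2 * t by linarith)]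
      with r hr
    have hr0 : 0 < r := by linarith [hr.1]
    refine LipschitzOnWith.of_dist_le_mul fun q hq q' hq' => ?_
    have e1 := hKF.dist_le_mul q hq.1 q' hq'.1
    have e2 := hKG.dist_le_mul q hq.2 q' hq'.2
    rw [Real.dist_eq, dist_eq_norm] at e1 e2
    rw [dist_eq_norm, dist_eq_norm, NNReal.coe_mk, div_mul_eq_mul_div, Prod.norm_def]
    refine max_le ?_ ?_
    · have e : (f r q - f r q').1 = -((q - q').2) / r := by simp [hf]; ring
      rw [e, norm_div, norm_neg, Real.norm_of_nonneg hr0.le]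
      have h1 : ‖(q - q').2‖ ≤ ‖q - q'‖ := norm_snd_le _
      refine div_le_div₀ (by positivity) ?_ (by positivity) hr.1.le
      have : 0 ≤ (KF + (2 * t) ^ 2 * KG) * ‖q - q'‖ := by positivity
      linarith
    · have e : (f r q - f r q').2 = ((-B q * q.2 - -B q' * q'.2) + r ^ 2 * (G q - G q')) / r := by
        simp [hf]; ring
      rw [e, norm_div, Real.norm_of_nonneg hr0.le]
      refine div_le_div₀ (by positivity) ?_ (by positivity) hr.1.le
      refine (norm_add_le _ _).trans ?_
      rw [norm_mul (r ^ 2), Real.norm_of_nonneg (sq_nonneg r), Real.norm_eq_abs, Real.norm_eq_abs]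
      have h3 : r ^ 2 * |G q - G q'| ≤ (2 * t) ^ 2 * (KG * ‖q - q'‖) :=
        mul_le_mul (pow_le_pow_left₀ hr0.le hr.2.le 2) e2 (abs_nonneg _) (by positivity)
      have nn := norm_nonneg (q - q')
      linarith
  have hpair : ∀ {l v : ℝ → ℝ}, (∀ᶠ r in 𝓝 t, SolvesAt B G l v r) → (l₁ t, v₁ t) = (l t, v t) →
      ∀ᶠ r in 𝓝 t, HasDerivAt (fun r => (l r, v r)) (f r (l r, v r)) r ∧
        (l r, v r) ∈ s₁ ∩ s₂ := by
    intro l v hs he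
    have hc : ContinuousAt (fun r => (l r, v r)) t :=
      hs.self_of_nhds.1.continuousAt.prodMk hs.self_of_nhds.2.continuousAt
    have hm : s₁ ∩ s₂ ∈ 𝓝 (l t, v t) := by
      rw [← he]
      exact inter_mem hs₁ hs₂
    filter_upwards [hs, hc hm] with r h1 h2
    exact ⟨h1.1.prodMk h1.2, h2⟩
  have := ODE_solution_unique_of_eventually (s := fun _ => s₁ ∩ s₂) hlip (hpair h₁ rfl)
    (hpair h₂ (by rw [hl, hv])) (by rw [hl, hv])
  filter_upwards [this] with r hr
  exact Prod.ext_iff.1 hr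

/-- Uniqueness of solutions with regular center. The second solution is only known to satisfy the
equations as long as it stays in the domain `U` of regularity of the coefficients. -/
theorem solution_unique {B G : ℝ × ℝ → ℝ} {U : Set (ℝ × ℝ)} (hU : IsOpen U)
    (hBU : ContDiffOn ℝ 1 B U) (hGU : ContDiffOn ℝ 1 G U) {l₀ : ℝ} (h0 : (l₀, (0 : ℝ)) ∈ U)
    (hB0 : 0 < B (l₀, 0)) (hG0 : 0 < G (l₀, 0)) {s : ℝ} {l₁ v₁ l₂ v₂ : ℝ → ℝ}
    (hl₁ : ContinuousOn l₁ (Ico 0 s)) (hv₁ : ContinuousOn v₁ (Ico 0 s)) (hl₁0 : l₁ 0 = l₀)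
    (hv₁0 : v₁ 0 = 0) (hl₂ : ContinuousOn l₂ (Ico 0 s)) (hv₂ : ContinuousOn v₂ (Ico 0 s))
    (hl₂0 : l₂ 0 = l₀) (hv₂0 : v₂ 0 = 0)
    (h₁ : ∀ r ∈ Ioo 0 s, (l₁ r, v₁ r) ∈ U ∧ SolvesAt B G l₁ v₁ r)
    (h₂ : ∀ r ∈ Ioo 0 s, (l₂ r, v₂ r) ∈ U → SolvesAt B G l₂ v₂ r) :
    ∀ r ∈ Ico 0 s, l₁ r = l₂ r ∧ v₁ r = v₂ r := by
  have hBat : ∀ q ∈ U, ContDiffAt ℝ 1 B q := fun q hq => hBU.contDiffAt (hU.mem_nhds hq)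
  have hGat : ∀ q ∈ U, ContDiffAt ℝ 1 G q := fun q hq => hGU.contDiffAt (hU.mem_nhds hq)
  intro b hb
  rcases hb.1.eq_or_lt with rfl | hb0
  · exact ⟨hl₁0.trans hl₂0.symm, hv₁0.trans hv₂0.symm⟩
  have hs0 : 0 < s := hb0.trans hb.2
  obtain ⟨ε, hε, M, hM, L, hL, ht⟩ := exists_tameOn_closedBall (hBat _ h0) (hGat _ h0) hB0 hG0
  have hnear : ∀ {l v : ℝ → ℝ}, ContinuousOn l (Ico 0 s) → ContinuousOn v (Ico 0 s) →
      l 0 = l₀ → v 0 = 0 → ∀ᶠ r in 𝓝[>] (0 : ℝ), (l r, v r) ∈ U ∩ closedBall (l₀, (0 : ℝ)) ε := by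
    intro l v hl hv hl0 hv0
    have hc : ContinuousWithinAt (fun r => (l r, v r)) (Ico 0 s) 0 :=
      (hl 0 ⟨le_rfl, hs0⟩).prodMk (hv 0 ⟨le_rfl, hs0⟩)
    have hmem : U ∩ closedBall (l₀, (0 : ℝ)) ε ∈ 𝓝 (l 0, v 0) := by
      rw [hl0, hv0]
      exact inter_mem (hU.mem_nhds h0) (closedBall_mem_nhds _ hε)
    have h1 := hc hmem
    have hle : 𝓝[>] (0 : ℝ) ≤ 𝓝[Ico 0 s] 0 := by
      rw [← nhdsWithin_Ioo_eq_nhdsGT hs0]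
      exact nhdsWithin_mono _ Ioo_subset_Ico_self
    exact hle h1
  obtain ⟨h, hh0, hhev⟩ := mem_nhdsGT_iff_exists_Ioo_subset.1
    ((hnear hl₁ hv₁ hl₁0 hv₁0).and (hnear hl₂ hv₂ hl₂0 hv₂0))
  have hh0 : 0 < h := hh0
  obtain ⟨h', hh', hh'1, hh'h, hh'b⟩ : ∃ h' > 0, h' ≤ 1 ∧ h' ≤ h ∧ h' ≤ b :=
    ⟨min 1 (min h b), by positivity, min_le_left _ _, (min_le_right _ _).trans (min_le_left _ _),
      (min_le_right _ _).trans (min_le_right _ _)⟩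
  have hsub : Icc 0 h' ⊆ Ico 0 s := Icc_subset_Ico_right (hh'b.trans_lt hb.2)
  have hev : ∀ r ∈ Ioo 0 h', (l₁ r, v₁ r) ∈ U ∩ closedBall (l₀, (0 : ℝ)) ε ∧
      (l₂ r, v₂ r) ∈ U ∩ closedBall (l₀, (0 : ℝ)) ε :=
    fun r hr => hhev ⟨hr.1, hr.2.trans_le hh'h⟩
  have hIoo : ∀ r ∈ Ioo 0 h', r ∈ Ioo 0 s := fun r hr => ⟨hr.1, (hr.2.trans_le hh'b).trans hb.2⟩
  have hloc := ht.eq_of_solvesAt hM hL (mem_closedBall_self hε.le) hB0 hh'1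
    (hl₁.mono hsub) (hv₁.mono hsub) hl₁0 hv₁0 (fun r hr => (hev r hr).1.2)
    (fun r hr => (h₁ r (hIoo r hr)).2) (hl₂.mono hsub) (hv₂.mono hsub) hl₂0 hv₂0
    (fun r hr => (hev r hr).2.2) (fun r hr => h₂ r (hIoo r hr) (hev r hr).2.1)
  -- Continuation of the equality: the coincidence set is closed, contains `h'`, and by local
  -- uniqueness is a neighborhood of each of its points in the interval.
  set S : Set ℝ := {r | (l₁ r, v₁ r) = (l₂ r, v₂ r)} with hS
  have hsub2 : Icc h' b ⊆ Ico 0 s := fun r hr => ⟨hh'.le.trans hr.1, hr.2.trans_lt hb.2⟩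
  have hclosed : IsClosed (S ∩ Icc h' b) := by
    have c1 := ((hl₁.mono hsub2).prodMk (hv₁.mono hsub2))
    have c2 := ((hl₂.mono hsub2).prodMk (hv₂.mono hsub2))
    have := (c1.prodMk c2).preimage_isClosed_of_isClosed isClosed_Icc
      (isClosed_diagonal (X := ℝ × ℝ))
    convert this using 1
    ext r
    simp [hS, and_comm]
  have hall : Icc h' b ⊆ S := by
    refine hclosed.Icc_subset_of_forall_mem_nhdsWithin
      (Prod.ext_iff.2 (hloc h' ⟨hh'.le, le_rfl⟩)) fun r hr => ?_
    have hr0 : r ∈ Ioo 0 s := ⟨hh'.trans_le hr.2.1, hr.2.2.trans hb.2⟩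
    have hnb : Ioo 0 s ∈ 𝓝 r := isOpen_Ioo.mem_nhds hr0
    obtain ⟨e1, e2⟩ := Prod.ext_iff.1 hr.1
    have hc2 : ContinuousAt (fun r => (l₂ r, v₂ r)) r :=
      (hl₂.continuousAt (mem_of_superset hnb Ioo_subset_Ico_self)).prodMk
        (hv₂.continuousAt (mem_of_superset hnb Ioo_subset_Ico_self))
    -- At a point of coincidence the second solution inherits membership in `U` from the first, and
    -- `U` is open. Hence its equations hold nearby.
    have hrU : (l₂ r, v₂ r) ∈ U := by
      rw [← show (l₁ r, v₁ r) = (l₂ r, v₂ r) from hr.1]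
      exact (h₁ r hr0).1
    have hU2 : ∀ᶠ t in 𝓝 r, (l₂ t, v₂ t) ∈ U := hc2 (hU.mem_nhds hrU)
    have := eventuallyEq_of_solvesAt hr0.1 (hBat _ (h₁ r hr0).1) (hGat _ (h₁ r hr0).1)
      (by filter_upwards [hnb] with t ht using (h₁ t ht).2)
      (by filter_upwards [hnb, hU2] with t ht ht2 using h₂ t ht ht2) e1 e2
    refine mem_nhdsWithin_of_mem_nhds ?_
    filter_upwards [this] with t ht using Prod.ext_iff.2 ht
  exact Prod.ext_iff.1 (hall ⟨hh'b, le_rfl⟩)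

/-! ### The constitutive functions along a curve -/

theorem isOpen_openQuadrant : IsOpen openQuadrant := isOpen_Ioi.prod isOpen_Ioi

/-- The chain rule needs the Fréchet derivative; its values on the two basis vectors are the partial
derivatives `d1` and `d2`. -/
theorem hasDerivAt_comp_quadrant {P : ℝ → ℝ → ℝ}
    (hP : ContDiffOn ℝ 2 (Function.uncurry P) openQuadrant) {X Y : ℝ → ℝ} {x' y' r : ℝ}
    (hX : HasDerivAt X x' r) (hY : HasDerivAt Y y' r) (hx : 0 < X r) (hy : 0 < Y r) :
    HasDerivAt (fun r => P (X r) (Y r)) (d1 P (X r) (Y r) * x' + d2 P (X r) (Y r) * y') r := by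
  have hmem : (X r, Y r) ∈ openQuadrant := ⟨hx, hy⟩
  have hF : HasFDerivAt (Function.uncurry P) (fderiv ℝ (Function.uncurry P) (X r, Y r))
      (X r, Y r) :=
    ((hP.contDiffAt (isOpen_openQuadrant.mem_nhds hmem)).differentiableAt (by simp)).hasFDerivAt
  set F := fderiv ℝ (Function.uncurry P) (X r, Y r)
  have e1 : d1 P (X r) (Y r) = F (1, 0) :=
    (hF.comp_hasDerivAt (f := fun u => (u, Y r)) (X r)
      ((hasDerivAt_id (X r)).prodMk (hasDerivAt_const (X r) (Y r)))).deriv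
  have e2 : d2 P (X r) (Y r) = F (0, 1) :=
    (hF.comp_hasDerivAt (f := fun u => (X r, u)) (Y r)
      ((hasDerivAt_const (Y r) (X r)).prodMk (hasDerivAt_id (Y r)))).deriv
  have h := hF.comp_hasDerivAt r (hX.prodMk hY)
  refine h.congr_deriv ?_
  have e3 : (x', y') = x' • ((1 : ℝ), (0 : ℝ)) + y' • ((0 : ℝ), (1 : ℝ)) := by simp
  rw [e3, map_add, map_smul, map_smul, e1, e2, smul_eq_mul, smul_eq_mul]
  ring

/-- At fixed `x`, `δ` is a multiple of `y`. This turns the sign of `Γ` into the sign of the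
derivative of the radial pressure with respect to `δ`. -/
theorem d2_inXY (h : ℝ → ℝ → ℝ) (x y : ℝ) :
    d2 (inXY h) x y = x ^ 3 * d1 h (x ^ 3 * y) (x ^ 3) := by
  unfold d2 d1 inXY
  exact deriv_comp_mul_left (x ^ 3) (fun u => h u (x ^ 3)) y

/-! ### Coefficients of the structure equations -/

/-- The coefficient `B / (1 - v)` of the structure equations. -/
noncomputable def coefB₁ (Γ Υ : ℝ → ℝ → ℝ) (p : ℝ × ℝ) : ℝ :=
  Υ (Real.exp p.1) (1 - p.2) / Γ (Real.exp p.1) (1 - p.2)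

/-- The coefficient `G / (1 - v)` of the structure equations. -/
noncomputable def coefG₁ (Γ : ℝ → ℝ → ℝ) (a b C : ℝ) (p : ℝ × ℝ) : ℝ :=
  C * Real.exp p.1 ^ a * Real.exp p.1 ^ 6 * (1 - p.2) ^ b / Γ (Real.exp p.1) (1 - p.2)

/-- The coefficient `B` of the structure equations. -/
noncomputable def coefB (Γ Υ : ℝ → ℝ → ℝ) (p : ℝ × ℝ) : ℝ := (1 - p.2) * coefB₁ Γ Υ p

/-- The coefficient `G` of the structure equations. -/
noncomputable def coefG (Γ : ℝ → ℝ → ℝ) (a b C : ℝ) (p : ℝ × ℝ) : ℝ := (1 - p.2) * coefG₁ Γ a b C p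

/-- The map `(ℓ, v) ↦ (x, y)`. -/
noncomputable def toXY (p : ℝ × ℝ) : ℝ × ℝ := (Real.exp p.1, 1 - p.2)

theorem contDiff_toXY : ContDiff ℝ 1 toXY := by
  unfold toXY
  fun_prop

/-- The domain of regularity of the structure equations. -/
def regularDomain (Γ : ℝ → ℝ → ℝ) : Set (ℝ × ℝ) :=
  {p | p.2 < 1 ∧ 0 < Γ (Real.exp p.1) (1 - p.2)}

section Constitutive

variable {hrad htan : ℝ → ℝ → ℝ} {lam mu a b c : ℝ} {Γ Υ : ℝ → ℝ → ℝ} {Xflat Xsharp : EReal}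

theorem toXY_mem_openQuadrant {p : ℝ × ℝ} (hp : p.2 < 1) : toXY p ∈ openQuadrant :=
  ⟨Real.exp_pos _, sub_pos.2 hp⟩

theorem openQuadrant_subset : openQuadrant ⊆ closedQuadrant :=
  prod_mono Ioi_subset_Ici_self Ioi_subset_Ici_self

theorem closedQuadrant_mem_nhds {q : ℝ × ℝ} (hq : q ∈ openQuadrant) : closedQuadrant ∈ 𝓝 q :=
  mem_of_superset (isOpen_openQuadrant.mem_nhds hq) openQuadrant_subset

theorem isOpen_regularDomain (hΓ : ContinuousOn (Function.uncurry Γ) closedQuadrant) :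
    IsOpen (regularDomain Γ) := by
  have hopen : IsOpen {p : ℝ × ℝ | p.2 < 1} := isOpen_lt continuous_snd continuous_const
  have hc : ContinuousOn (fun p => Function.uncurry Γ (toXY p)) {p : ℝ × ℝ | p.2 < 1} :=
    hΓ.comp contDiff_toXY.continuous.continuousOn
      fun p hp => openQuadrant_subset (toXY_mem_openQuadrant hp)
  exact hc.isOpen_inter_preimage hopen isOpen_Ioi

theorem contDiffOn_coefB_regularDomain
    (hΓ : ContDiffOn ℝ 1 (Function.uncurry Γ) closedQuadrant)
    (hΥ : ContDiffOn ℝ 1 (Function.uncurry Υ) closedQuadrant) :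
    ContDiffOn ℝ 1 (coefB Γ Υ) (regularDomain Γ) := by
  intro p hp
  have hq := closedQuadrant_mem_nhds (toXY_mem_openQuadrant hp.1)
  have h1 : ContDiffAt ℝ 1 (fun p => Function.uncurry Γ (toXY p)) p :=
    (hΓ.contDiffAt hq).comp p contDiff_toXY.contDiffAt
  have h2 : ContDiffAt ℝ 1 (fun p => Function.uncurry Υ (toXY p)) p :=
    (hΥ.contDiffAt hq).comp p contDiff_toXY.contDiffAt
  exact ((contDiffAt_const.sub contDiffAt_snd).mul (h2.div h1 hp.2.ne')).contDiffWithinAt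

theorem contDiffOn_coefG_regularDomain
    (hΓ : ContDiffOn ℝ 1 (Function.uncurry Γ) closedQuadrant) (a b C : ℝ) :
    ContDiffOn ℝ 1 (coefG Γ a b C) (regularDomain Γ) := by
  intro p hp
  have hq := closedQuadrant_mem_nhds (toXY_mem_openQuadrant hp.1)
  have h1 : ContDiffAt ℝ 1 (fun p => Function.uncurry Γ (toXY p)) p :=
    (hΓ.contDiffAt hq).comp p contDiff_toXY.contDiffAt
  have h3 : ContDiffAt ℝ 1 (fun p : ℝ × ℝ => Real.exp p.1) p := by fun_prop
  have h4 : ContDiffAt ℝ 1 (fun p : ℝ × ℝ => 1 - p.2) p := by fun_prop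
  exact (h4.mul ((((contDiffAt_const.mul (h3.rpow_const_of_ne (Real.exp_ne_zero _))).mul
    (h3.pow 6)).mul (h4.rpow_const_of_ne (sub_pos.2 hp.1).ne')).div h1 hp.2.ne')).contDiffWithinAt

theorem toXY_mem_closedQuadrant {l₀ : ℝ} {p : ℝ × ℝ} (hp : p ∈ rect l₀) :
    toXY p ∈ closedQuadrant :=
  ⟨(Real.exp_pos _).le, sub_nonneg.2 hp.2.2⟩

theorem ConstitutiveAssumptions.gamma_pos
    (hyp : ConstitutiveAssumptions hrad htan lam mu a b c Γ Υ Xflat Xsharp) {x y : ℝ}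
    (hx : 0 < x) (hX : (x : EReal) < Xflat) (hy : 0 ≤ y) (hy1 : y ≤ 1) : 0 < Γ x y := by
  rcases hy1.eq_or_lt with rfl | h
  · exact hyp.central.gamma_pos x hx hX
  · exact hyp.global.gamma_pos x y hx.le hX hy h

/-- Along the rectangle `1 ≤ x ≤ exp l₀ < X_♭` and `0 ≤ y ≤ 1`, so `Γ` is positive and the quotients
are regular up to the edge `y = 0`. -/
theorem ConstitutiveAssumptions.continuationHyp
    (hyp : ConstitutiveAssumptions hrad htan lam mu a b c Γ Υ Xflat Xsharp) {l₀ C : ℝ}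
    (hC : 0 < C) (hX : (Real.exp l₀ : EReal) < Xflat) :
    ContinuationHyp (coefB₁ Γ Υ) (coefG₁ Γ a b C) (coefB Γ Υ) (coefG Γ a b C) l₀ := by
  have hpos : ∀ p ∈ rect l₀, 0 < Γ (Real.exp p.1) (1 - p.2) := fun p hp =>
    hyp.gamma_pos (Real.exp_pos _)
      (lt_of_le_of_lt (by exact_mod_cast Real.exp_le_exp.2 hp.1.2) hX)
      (sub_nonneg.2 hp.2.2) (by linarith [hp.2.1])
  have hmaps : MapsTo toXY (rect l₀) closedQuadrant := fun p hp => toXY_mem_closedQuadrant hp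
  have h1 : ContDiffOn ℝ 1 (fun p => Function.uncurry Γ (toXY p)) (rect l₀) :=
    hyp.global.gamma_C1.comp contDiff_toXY.contDiffOn hmaps
  have h2 : ContDiffOn ℝ 1 (fun p => Function.uncurry Υ (toXY p)) (rect l₀) :=
    hyp.global.upsilon_C1.comp contDiff_toXY.contDiffOn hmaps
  have h3 : ContDiff ℝ 1 (fun p : ℝ × ℝ => Real.exp p.1) := by fun_prop
  have h4 : ContDiff ℝ 1 (fun p : ℝ × ℝ => 1 - p.2) := by fun_prop
  have h5 : ContDiff ℝ 1 (fun p : ℝ × ℝ => C * Real.exp p.1 ^ a * Real.exp p.1 ^ 6) :=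
    (contDiff_const.mul (h3.rpow_const_of_ne fun p => Real.exp_ne_zero _)).mul (h3.pow 6)
  have hB₁ : ContDiffOn ℝ 1 (coefB₁ Γ Υ) (rect l₀) := h2.div h1 fun p hp => (hpos p hp).ne'
  refine ⟨fun p => rfl, fun p => rfl, h4.contDiffOn.mul hB₁, ?_, hB₁.continuousOn, ?_, ?_, ?_⟩
  -- For `b < 1` the power `y^b` is not `C¹` at `y = 0`; the extra factor `y` in `G` raises the
  -- exponent to `1 + b > 1`.
  · have h6 : ContDiff ℝ 1 (fun p : ℝ × ℝ => (1 - p.2) ^ (1 + b)) :=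
      (Real.contDiff_rpow_const_of_le (n := 1) (by push_cast; linarith [hyp.b_pos])).comp h4
    refine ((h5.contDiffOn.mul h6.contDiffOn).div h1 fun p hp => (hpos p hp).ne').congr
      fun p hp => ?_
    have : (1 - p.2) ^ (1 + b) = (1 - p.2) * (1 - p.2) ^ b :=
      Real.rpow_one_add' (sub_nonneg.2 hp.2.2) (by linarith [hyp.b_pos])
    simp only [coefG, coefG₁, toXY, Function.uncurry_apply_pair, Pi.div_apply, this]
    ring
  · have h6 : Continuous (fun p : ℝ × ℝ => (1 - p.2) ^ b) :=
      h4.continuous.rpow_const fun p => Or.inr hyp.b_pos.le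
    exact (h5.continuous.continuousOn.mul h6.continuousOn).div h1.continuousOn
      fun p hp => (hpos p hp).ne'
  · intro p hp
    have := hpos p hp
    have : 0 ≤ 1 - p.2 := sub_nonneg.2 hp.2.2
    unfold coefG₁
    positivity
  · intro p hp hp1
    have := hpos p hp
    have : 0 < 1 - p.2 := sub_pos.2 hp1
    unfold coefG₁
    positivity

/-- The constant `C` in the coefficient `G` for the reference density `K`. -/
noncomputable def gravConst (lam mu K : ℝ) : ℝ := 4 * Real.pi / 3 * K ^ 2 / (lam + 2 * mu)

/-- Hydrostatic equilibrium is equivalent to the second structure equation. -/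
theorem ConstitutiveAssumptions.equilibrium_iff
    (hyp : ConstitutiveAssumptions hrad htan lam mu a b c Γ Υ Xflat Xsharp) {K l v v' r : ℝ}
    (hr : 0 < r) (hv : v < 1) (hΓ : 0 < Γ (Real.exp l) (1 - v)) :
    (d1 (inXY hrad) (Real.exp l) (1 - v) * (Real.exp l * (-v / r)) +
        d2 (inXY hrad) (Real.exp l) (1 - v) * -v' =
      -(2 / r) * (inXY hrad (Real.exp l) (1 - v) - inXY htan (Real.exp l) (1 - v)) -
        K * (Real.exp l ^ 3 * (1 - v)) *
          (Real.exp l ^ 3 * (4 * Real.pi / 3 * K * r ^ 3) / r ^ 2)) ↔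
    v' = (-coefB Γ Υ (l, v) * v + r ^ 2 * coefG Γ a b (gravConst lam mu K) (l, v)) / r := by
  have hk := hyp.linear.elliptic
  have hx : 0 < Real.exp l := Real.exp_pos l
  have hy : 0 < 1 - v := sub_pos.2 hv
  have hg := hyp.power_law.gamma_eq _ _ hx hy
  have hu := hyp.power_law.upsilon_eq _ _ hx hy
  -- Equality of the pressures at `y = 1` makes this hold at `v = 0` too, so the pressure anisotropy
  -- is always a multiple of `v`.
  have hΘ : inXY htan (Real.exp l) (1 - v) - inXY hrad (Real.exp l) (1 - v) =
      Theta (inXY hrad) (inXY htan) (Real.exp l) (1 - v) * v := by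
    unfold Theta
    split_ifs with h
    · have hv0 : v = 0 := by linarith
      rw [hv0, sub_zero, hyp.equal_center _ hx]
      ring
    · have hv0 : v ≠ 0 := fun h0 => h (by rw [h0, sub_zero])
      rw [sub_sub_cancel, div_mul_cancel₀ _ hv0]
  unfold coefB coefG coefB₁ coefG₁ gravConst
  simp only
  have hyb : (1 - v) * (1 - v) ^ (b - 1 + c) = (1 - v) ^ b := by
    rw [hyp.c_zero, add_zero, Real.rpow_sub_one hy.ne', mul_div_cancel₀ _ hy.ne']
  -- Because `c = 0`, the same positive factor `A` occurs in `Γ`, `y Υ` and the numerator of `G`,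
  -- and cancels from the quotients.
  generalize hA : (lam + 2 * mu)⁻¹ * Real.exp l ^ a * (1 - v) ^ b = A at hg
  have hA0 : 0 < A := by rw [← hA]; positivity
  have hu' : (1 - v) * Υ (Real.exp l) (1 - v) = A * (Real.exp l *
      d1 (inXY hrad) (Real.exp l) (1 - v) +
        2 * Theta (inXY hrad) (inXY htan) (Real.exp l) (1 - v)) := by
    rw [hu, ← hA, ← hyb]
    ring
  have hG : 4 * Real.pi / 3 * K ^ 2 / (lam + 2 * mu) * Real.exp l ^ a * Real.exp l ^ 6 *
      (1 - v) ^ b = A * (4 * Real.pi / 3 * K ^ 2) * Real.exp l ^ 6 := by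
    rw [← hA]
    field_simp
  have hptan : inXY hrad (Real.exp l) (1 - v) - inXY htan (Real.exp l) (1 - v) =
      -(Theta (inXY hrad) (inXY htan) (Real.exp l) (1 - v) * v) := by rw [← hΘ]; ring
  rw [hptan, hG, ← mul_div_assoc (1 - v) (Υ (Real.exp l) (1 - v)), hu', hg]
  have hD : d2 (inXY hrad) (Real.exp l) (1 - v) ≠ 0 := by
    intro h0
    rw [h0, mul_zero] at hg
    exact hΓ.ne' hg
  generalize d2 (inXY hrad) (Real.exp l) (1 - v) = D at hD
  generalize d1 (inXY hrad) (Real.exp l) (1 - v) = E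
  generalize Theta (inXY hrad) (inXY htan) (Real.exp l) (1 - v) = Θ
  generalize Real.exp l = x
  constructor
  · intro h
    field_simp at h ⊢
    linarith
  · intro h
    rw [h]
    field_simp
    ring

end Constitutive

/-! ### The structure equations of a ball -/

/-- The logarithm of `x = η^{1/3}`, continuously extended to the center. -/
noncomputable def logX (K : ℝ) (ρ : ℝ → ℝ) (r : ℝ) : ℝ :=
  if r = 0 then Real.log (ρ 0 / K) / 3 else Real.log (eta K ρ r) / 3

/-- `1 - y = 1 - δ/η`, continuously extended to the center. -/
noncomputable def oneSubY (K : ℝ) (ρ : ℝ → ℝ) (r : ℝ) : ℝ :=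
  if r = 0 then 0 else 1 - delta K ρ r / eta K ρ r

/-- For a continuous density, `η` extends continuously to the center. -/
theorem exists_continuous_eta {K R : ℝ} (hK : 0 < K) (hR : 0 < R) {ρ : ℝ → ℝ}
    (hρ : ContinuousOn ρ (Icc 0 R)) :
    ∃ E : ℝ → ℝ, Continuous E ∧ E 0 = ρ 0 / K ∧ ∀ r ∈ Ioc 0 R, eta K ρ r = E r := by
  set σ : ℝ → ℝ := IccExtend hR.le ((Icc 0 R).domRestrict ρ) with hσ
  have hσc : Continuous σ := (continuousOn_iff_continuous_domRestrict.1 hρ).Icc_extend'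
  have hσe : ∀ r ∈ Icc 0 R, σ r = ρ r := fun r hr => by
    rw [hσ, IccExtend_of_mem _ _ hr]; rfl
  -- Rescaling the mass integral by `s = t r` absorbs the factor `r³`, leaving an average of the
  -- density that is continuous at `0`.
  refine ⟨fun r => 3 / K * ∫ t in (0 : ℝ)..1, σ (t * r) * t ^ 2, ?_, ?_, ?_⟩
  · refine continuous_const.mul
      (intervalIntegral.continuous_parametric_intervalIntegral_of_continuous'
        (f := fun r t => σ (t * r) * t ^ 2) ?_ 0 1)
    exact (hσc.comp (by fun_prop)).mul (by fun_prop)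
  · simp only [mul_zero]
    rw [hσe 0 ⟨le_rfl, hR.le⟩, intervalIntegral.integral_const_mul, integral_pow]
    field_simp
    norm_num [mul_comm]
  · intro r hr
    have hr0 := hr.1.ne'
    have h1 := intervalIntegral.integral_comp_mul_right (a := 0) (b := 1)
      (fun s : ℝ => σ s * s ^ 2) hr0
    have h2 : ∫ s in (0 : ℝ)..r, σ s * s ^ 2 = ∫ s in (0 : ℝ)..r, ρ s * s ^ 2 := by
      refine intervalIntegral.integral_congr fun s hs => ?_
      rw [uIcc_of_le hr.1.le] at hs
      simp only [hσe s ⟨hs.1, hs.2.trans hr.2⟩]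
    have h3 : ∫ t in (0 : ℝ)..1, σ (t * r) * (t * r) ^ 2 =
        r ^ 2 * ∫ t in (0 : ℝ)..1, σ (t * r) * t ^ 2 := by
      rw [← intervalIntegral.integral_const_mul]
      refine intervalIntegral.integral_congr fun t _ => ?_
      ring
    rw [h3, zero_mul, one_mul, h2, smul_eq_mul] at h1
    have h4 : ∫ s in (0 : ℝ)..r, ρ s * s ^ 2 =
        r ^ 3 * ∫ t in (0 : ℝ)..1, σ (t * r) * t ^ 2 := by
      have : r ^ 3 * ∫ t in (0 : ℝ)..1, σ (t * r) * t ^ 2 =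
          r * (r ^ 2 * ∫ t in (0 : ℝ)..1, σ (t * r) * t ^ 2) := by ring
      rw [this, h1, mul_inv_cancel_left₀ hr0]
    rw [eta, mass, h4]
    have := Real.pi_pos
    field_simp

section Ball

variable {hrad htan : ℝ → ℝ → ℝ} {K R : ℝ} {ρ prad ptan : ℝ → ℝ}

theorem IsRegularBall.rho_pos (ball : IsRegularBall R ρ prad ptan) {r : ℝ} (hr : r ∈ Ioo 0 R) :
    0 < ρ r := by
  rw [← ball.support] at hr
  exact (interior_subset hr).2

theorem IsRegularBall.intervalIntegrable (ball : IsRegularBall R ρ prad ptan) {r : ℝ}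
    (hr : r ∈ Icc 0 R) : IntervalIntegrable (fun s => ρ s * s ^ 2) volume 0 r := by
  refine ContinuousOn.intervalIntegrable ?_
  rw [uIcc_of_le hr.1]
  exact (ball.regular_rho.1.mono (Icc_subset_Icc_right hr.2)).mul (by fun_prop)

theorem IsRegularBall.eta_pos (ball : IsRegularBall R ρ prad ptan) (hK : 0 < K) {r : ℝ}
    (hr : r ∈ Ioc 0 R) : 0 < eta K ρ r := by
  have hI : 0 < ∫ s in (0 : ℝ)..r, ρ s * s ^ 2 :=
    intervalIntegral.intervalIntegral_pos_of_pos_on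
      (ball.intervalIntegrable ⟨hr.1.le, hr.2⟩)
      (fun s hs => mul_pos (ball.rho_pos ⟨hs.1, hs.2.trans_le hr.2⟩) (pow_pos hs.1 2)) hr.1
  have := Real.pi_pos
  have := hr.1
  unfold eta mass
  positivity

theorem IsRegularBall.hasDerivAt_mass (ball : IsRegularBall R ρ prad ptan) {r : ℝ}
    (hr : r ∈ Ioo 0 R) : HasDerivAt (mass ρ) (4 * Real.pi * (ρ r * r ^ 2)) r := by
  have hc : ∀ t ∈ Ioo 0 R, ContinuousAt (fun s => ρ s * s ^ 2) t := fun t ht =>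
    (ball.regular_rho.1.continuousAt (Icc_mem_nhds ht.1 ht.2)).mul (by fun_prop)
  have hm : StronglyMeasurableAtFilter (fun s => ρ s * s ^ 2) (𝓝 r) volume :=
    ContinuousAt.stronglyMeasurableAtFilter isOpen_Ioo hc r hr
  exact (intervalIntegral.integral_hasDerivAt_right
    (ball.intervalIntegrable (Ioo_subset_Icc_self hr)) hm (hc r hr)).const_mul _

theorem mass_eq_eta (hK : 0 < K) {r : ℝ} (hr : 0 < r) :
    mass ρ r = eta K ρ r * (4 * Real.pi / 3 * K * r ^ 3) := by
  have := Real.pi_pos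
  unfold eta
  rw [div_mul_cancel₀ _ (by positivity)]

/-- Differentiating the mean density. After taking logarithms this is the first structure equation
`r ℓ' = -v`. -/
theorem IsRegularBall.hasDerivAt_eta (ball : IsRegularBall R ρ prad ptan) (hK : 0 < K) {r : ℝ}
    (hr : r ∈ Ioo 0 R) : HasDerivAt (eta K ρ) (3 * (delta K ρ r - eta K ρ r) / r) r := by
  have hr0 := hr.1
  have hpi := Real.pi_pos
  have hd : HasDerivAt (fun r : ℝ => 4 * Real.pi / 3 * K * r ^ 3)
      (4 * Real.pi / 3 * K * (3 * r ^ 2)) r := by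
    simpa using (hasDerivAt_pow 3 r).const_mul (4 * Real.pi / 3 * K)
  refine ((ball.hasDerivAt_mass hr).div hd (by positivity)).congr_deriv ?_
  rw [mass_eq_eta (ρ := ρ) hK hr0, delta]
  field_simp

theorem exp_logX_pow (hη : 0 < eta K ρ R) (hR : R ≠ 0) :
    Real.exp (logX K ρ R) ^ 3 = eta K ρ R := by
  rw [logX, if_neg hR, ← Real.exp_nat_mul]
  push_cast
  rw [mul_div_cancel₀ _ (by norm_num), Real.exp_log hη]

theorem exp_logX_pow_mul (hη : 0 < eta K ρ R) (hR : R ≠ 0) :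
    Real.exp (logX K ρ R) ^ 3 * (1 - oneSubY K ρ R) = delta K ρ R := by
  rw [exp_logX_pow hη hR, oneSubY, if_neg hR, sub_sub_cancel, mul_div_cancel₀ _ hη.ne']

theorem IsRegularBall.continuousOn_logX (ball : IsRegularBall R ρ prad ptan) (hK : 0 < K)
    (h0 : 0 < ρ 0) : ContinuousOn (logX K ρ) (Icc 0 R) := by
  obtain ⟨E, hE, hE0, hEe⟩ := exists_continuous_eta hK ball.radius_pos ball.regular_rho.1
  have he : ∀ r ∈ Icc 0 R, 0 < E r ∧ logX K ρ r = Real.log (E r) / 3 := by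
    intro r hr
    rcases hr.1.eq_or_lt with rfl | hr0
    · rw [logX, if_pos rfl, hE0]
      exact ⟨by positivity, rfl⟩
    · rw [logX, if_neg hr0.ne', hEe r ⟨hr0, hr.2⟩, ← hEe r ⟨hr0, hr.2⟩]
      exact ⟨ball.eta_pos hK ⟨hr0, hr.2⟩, rfl⟩
  exact ((hE.continuousOn.log fun r hr => (he r hr).1.ne').div_const 3).congr
    fun r hr => (he r hr).2

theorem IsRegularBall.continuousOn_oneSubY (ball : IsRegularBall R ρ prad ptan) (hK : 0 < K)
    (h0 : 0 < ρ 0) : ContinuousOn (oneSubY K ρ) (Icc 0 R) := by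
  obtain ⟨E, hE, hE0, hEe⟩ := exists_continuous_eta hK ball.radius_pos ball.regular_rho.1
  have he : ∀ r ∈ Icc 0 R, 0 < E r ∧ oneSubY K ρ r = 1 - ρ r / K / E r := by
    intro r hr
    rcases hr.1.eq_or_lt with rfl | hr0
    · rw [oneSubY, if_pos rfl, hE0]
      have : 0 < ρ 0 / K := by positivity
      exact ⟨this, by rw [div_self this.ne', sub_self]⟩
    · rw [oneSubY, if_neg hr0.ne', ← hEe r ⟨hr0, hr.2⟩]
      exact ⟨ball.eta_pos hK ⟨hr0, hr.2⟩, rfl⟩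
  refine ContinuousOn.congr ?_ fun r hr => (he r hr).2
  exact continuousOn_const.sub ((ball.regular_rho.1.div_const K).div hE.continuousOn
    fun r hr => (he r hr).1.ne')

theorem IsRegularBall.hasDerivAt_logX (ball : IsRegularBall R ρ prad ptan) (hK : 0 < K) {r : ℝ}
    (hr : r ∈ Ioo 0 R) : HasDerivAt (logX K ρ) (-oneSubY K ρ r / r) r := by
  have hη := ball.eta_pos hK (Ioo_subset_Ioc_self hr)
  have he : logX K ρ =ᶠ[𝓝 r] fun r => Real.log (eta K ρ r) / 3 := by
    filter_upwards [isOpen_Ioo.mem_nhds hr] with t ht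
    rw [logX, if_neg ht.1.ne']
  refine ((((ball.hasDerivAt_eta hK hr).log hη.ne').div_const 3).congr_of_eventuallyEq
    he).congr_deriv ?_
  rw [oneSubY, if_neg hr.1.ne']
  have := hr.1
  field_simp
  ring

theorem IsRegularBall.differentiableAt_oneSubY (ball : IsRegularBall R ρ prad ptan) (hK : 0 < K)
    {r : ℝ} (hr : r ∈ Ioo 0 R) : DifferentiableAt ℝ (oneSubY K ρ) r := by
  have hη := ball.eta_pos hK (Ioo_subset_Ioc_self hr)
  have he : oneSubY K ρ =ᶠ[𝓝 r] fun r => 1 - ρ r / K / eta K ρ r := by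
    filter_upwards [isOpen_Ioo.mem_nhds hr] with t ht
    rw [oneSubY, if_neg ht.1.ne', delta]
  have hρ : DifferentiableAt ℝ ρ r :=
    (ball.regular_rho.2.differentiableOn (by simp)).differentiableAt (Ioc_mem_nhds hr.1 hr.2)
  exact (((hρ.div_const K).div (ball.hasDerivAt_eta hK hr).differentiableAt
    hη.ne').const_sub 1).congr_of_eventuallyEq he

variable {lam mu a b c : ℝ} {Γ Υ : ℝ → ℝ → ℝ} {Xflat Xsharp : EReal}

/-- The structure equations hold along any ball, in the domain of regularity. -/
theorem ConstitutiveAssumptions.solvesAt_of_ball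
    (hyp : ConstitutiveAssumptions hrad htan lam mu a b c Γ Υ Xflat Xsharp)
    (ball : IsRegularElasticBall hrad htan K R ρ prad ptan) (hK : 0 < K) {r : ℝ}
    (hr : r ∈ Ioo 0 R) (hreg : (logX K ρ r, oneSubY K ρ r) ∈ regularDomain Γ) :
    SolvesAt (coefB Γ Υ) (coefG Γ a b (gravConst lam mu K)) (logX K ρ) (oneSubY K ρ) r := by
  have hl := ball.hasDerivAt_logX hK hr
  have hv := (ball.differentiableAt_oneSubY hK hr).hasDerivAt
  refine ⟨hl, ?_⟩
  have hη := fun t (ht : t ∈ Ioo 0 R) => ball.eta_pos hK (Ioo_subset_Ioc_self ht)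
  have hPr : ∀ t ∈ Ioo 0 R,
      prad t = inXY hrad (Real.exp (logX K ρ t)) (1 - oneSubY K ρ t) := fun t ht => by
    rw [ball.eos_rad t (Ioo_subset_Ioc_self ht), inXY, exp_logX_pow_mul (hη t ht) ht.1.ne',
      exp_logX_pow (hη t ht) ht.1.ne']
  have hPt : ptan r = inXY htan (Real.exp (logX K ρ r)) (1 - oneSubY K ρ r) := by
    rw [ball.eos_tan r (Ioo_subset_Ioc_self hr), inXY, exp_logX_pow_mul (hη r hr) hr.1.ne',
      exp_logX_pow (hη r hr) hr.1.ne']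
  have hd := hasDerivAt_comp_quadrant hyp.rad_C2 hl.exp (hv.const_sub 1) (Real.exp_pos _)
    (sub_pos.2 hreg.1)
  obtain ⟨Φ, hΦ⟩ := ball.equilibrium
  obtain ⟨h1, h2⟩ := hΦ r hr
  have he : prad =ᶠ[𝓝 r] fun t => inXY hrad (Real.exp (logX K ρ t)) (1 - oneSubY K ρ t) := by
    filter_upwards [isOpen_Ioo.mem_nhds hr] with t ht using hPr t ht
  have heq := (h2.congr_of_eventuallyEq he.symm).unique hd
  have hρ : ρ r = K * (Real.exp (logX K ρ r) ^ 3 * (1 - oneSubY K ρ r)) := by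
    rw [exp_logX_pow_mul (hη r hr) hr.1.ne', delta, mul_div_cancel₀ _ hK.ne']
  rw [h1.deriv, hPr r hr, hPt, hρ, mass_eq_eta hK hr.1, ← exp_logX_pow (hη r hr) hr.1.ne'] at heq
  rw [(hyp.equilibrium_iff hr.1 hreg.1 hreg.2).1 heq.symm] at hv
  exact hv

/-- At `y = 1` the coefficients reduce to `Υ / Γ` and a positive multiple of `1 / Γ`, whose signs
are prescribed below `X_♭`. -/
theorem ConstitutiveAssumptions.coef_center_pos
    (hyp : ConstitutiveAssumptions hrad htan lam mu a b c Γ Υ Xflat Xsharp) (hK : 0 < K) {l₀ : ℝ}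
    (hX : (Real.exp l₀ : EReal) < Xflat) :
    (l₀, (0 : ℝ)) ∈ regularDomain Γ ∧ 0 < coefB Γ Υ (l₀, 0) ∧
      0 < coefG Γ a b (gravConst lam mu K) (l₀, 0) := by
  have h1 := hyp.central.gamma_pos _ (Real.exp_pos l₀) hX
  have h2 := hyp.central.upsilon_pos _ (Real.exp_pos l₀) hX
  have hk := hyp.linear.elliptic
  have := Real.pi_pos
  refine ⟨⟨one_pos, by simpa using h1⟩, ?_, ?_⟩
  · simp only [coefB, coefB₁, sub_zero, one_mul]
    positivity
  · simp only [coefG, coefG₁, gravConst, sub_zero, one_mul, Real.one_rpow, mul_one]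
    positivity

/-- Two balls with the same central density are equal, if one of them stays in the domain of
regularity. -/
theorem ConstitutiveAssumptions.ball_unique
    (hyp : ConstitutiveAssumptions hrad htan lam mu a b c Γ Υ Xflat Xsharp) (hK : 0 < K)
    (ball : IsRegularElasticBall hrad htan K R ρ prad ptan) (h0 : 0 < ρ 0)
    (hX : (Real.exp (logX K ρ 0) : EReal) < Xflat)
    (hreg : ∀ r ∈ Ioo 0 R, (logX K ρ r, oneSubY K ρ r) ∈ regularDomain Γ)
    {R' : ℝ} {ρ' prad' ptan' : ℝ → ℝ}
    (ball' : IsRegularElasticBall hrad htan K R' ρ' prad' ptan') (h0' : ρ' 0 = ρ 0) :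
    R' = R ∧ ∀ r, 0 ≤ r → ρ' r = ρ r ∧ prad' r = prad r ∧ ptan' r = ptan r := by
  obtain ⟨hc1, hc2, hc3⟩ := hyp.coef_center_pos hK hX
  have h0'' : 0 < ρ' 0 := by rw [h0']; exact h0
  have hR := ball.radius_pos
  have hR' := ball'.radius_pos
  set s := min R R' with hs
  have hs0 : 0 < s := lt_min hR hR'
  have hsub : Ico 0 s ⊆ Icc 0 R := fun r hr => ⟨hr.1, hr.2.le.trans (min_le_left _ _)⟩
  have hsub' : Ico 0 s ⊆ Icc 0 R' := fun r hr => ⟨hr.1, hr.2.le.trans (min_le_right _ _)⟩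
  have hIoo : ∀ r ∈ Ioo 0 s, r ∈ Ioo 0 R := fun r hr => ⟨hr.1, hr.2.trans_le (min_le_left _ _)⟩
  have hIoo' : ∀ r ∈ Ioo 0 s, r ∈ Ioo 0 R' := fun r hr =>
    ⟨hr.1, hr.2.trans_le (min_le_right _ _)⟩
  have huniq := solution_unique (isOpen_regularDomain hyp.power_law.gamma_cont)
    (contDiffOn_coefB_regularDomain hyp.global.gamma_C1 hyp.global.upsilon_C1)
    (contDiffOn_coefG_regularDomain hyp.global.gamma_C1 a b (gravConst lam mu K))
    hc1 hc2 hc3 ((ball.continuousOn_logX hK h0).mono hsub)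
    ((ball.continuousOn_oneSubY hK h0).mono hsub) rfl (if_pos rfl)
    ((ball'.continuousOn_logX hK h0'').mono hsub')
    ((ball'.continuousOn_oneSubY hK h0'').mono hsub') (by simp [logX, h0']) (if_pos rfl)
    (fun r hr => ⟨hreg r (hIoo r hr), hyp.solvesAt_of_ball ball hK (hIoo r hr) (hreg r (hIoo r hr))⟩)
    (fun r hr hr2 => hyp.solvesAt_of_ball ball' hK (hIoo' r hr) hr2)
  have heq : ∀ r ∈ Ioo 0 s, ρ' r = ρ r ∧ prad' r = prad r ∧ ptan' r = ptan r := by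
    intro r hr
    obtain ⟨e1, e2⟩ := huniq r (Ioo_subset_Ico_self hr)
    have hr1 := Ioo_subset_Ioc_self (hIoo r hr)
    have hr2 := Ioo_subset_Ioc_self (hIoo' r hr)
    have hη := ball.eta_pos hK hr1
    have hη' := ball'.eta_pos hK hr2
    have hr0 := hr.1.ne'
    have hδ : delta K ρ' r = delta K ρ r := by
      rw [← exp_logX_pow_mul hη hr0, ← exp_logX_pow_mul hη' hr0, e1, e2]
    have hee : eta K ρ' r = eta K ρ r := by
      rw [← exp_logX_pow hη hr0, ← exp_logX_pow hη' hr0, e1]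
    refine ⟨?_, ?_, ?_⟩
    · unfold delta at hδ
      field_simp at hδ
      exact hδ
    · rw [ball.eos_rad r hr1, ball'.eos_rad r hr2, hδ, hee]
    · rw [ball.eos_tan r hr1, ball'.eos_tan r hr2, hδ, hee]
  have hext : ∀ {f g : ℝ → ℝ}, ContinuousOn f (Icc 0 R') → ContinuousOn g (Icc 0 R) →
      (∀ r ∈ Ioo 0 s, f r = g r) → ∀ r ∈ Icc 0 s, f r = g r := by
    intro f g hf hg h
    have hEq : EqOn f g (Ioo 0 s) := h
    exact hEq.of_subset_closure (hf.mono (Icc_subset_Icc_right (min_le_right _ _)))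
      (hg.mono (Icc_subset_Icc_right (min_le_left _ _))) Ioo_subset_Icc_self
      (by rw [closure_Ioo hs0.ne])
  have hprad := hext ball'.regular_prad.1 ball.regular_prad.1 fun r hr => (heq r hr).2.1
  have hss : s ∈ Icc 0 s := ⟨hs0.le, le_rfl⟩
  -- The radial pressure vanishes at the smaller radius, whereas the ball with the larger radius has
  -- positive pressure there.
  have hRR : R' = R := by
    rcases lt_trichotomy R' R with h | h | h
    · have hsR : s = R' := min_eq_right h.le
      have h1 := hprad s hss
      rw [hsR, ball'.prad_boundary] at h1
      exact absurd h1 (ball.prad_pos R' ⟨hR'.le, h⟩).ne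
    · exact h
    · have hsR : s = R := min_eq_left h.le
      have h1 := hprad s hss
      rw [hsR, ball.prad_boundary] at h1
      exact absurd h1 (ball'.prad_pos R ⟨hR.le, h⟩).ne'
  refine ⟨hRR, fun r hr => ?_⟩
  rcases le_or_gt r R with hrR | hrR
  · have hrs : r ∈ Icc 0 s := ⟨hr, by rw [hs, hRR, min_self]; exact hrR⟩
    exact ⟨hext ball'.regular_rho.1 ball.regular_rho.1 (fun r hr => (heq r hr).1) r hrs,
      hprad r hrs, hext ball'.regular_ptan.1 ball.regular_ptan.1 (fun r hr => (heq r hr).2.2) r hrs⟩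
  · obtain ⟨a1, a2, a3⟩ := ball.vacuum r hrR
    obtain ⟨b1, b2, b3⟩ := ball'.vacuum r (hRR ▸ hrR)
    rw [a1, a2, a3, b1, b2, b3]
    exact ⟨rfl, rfl, rfl⟩

end Ball

/-! ### Existence of balls -/

theorem contDiffOn_one_of_hasDerivAt {f f' : ℝ → ℝ} {s : Set ℝ} (hs : IsOpen s)
    (hf : ∀ r ∈ s, HasDerivAt f (f' r) r) (hf' : ContinuousOn f' s) : ContDiffOn ℝ 1 f s := by
  rw [show (1 : WithTop ℕ∞) = 0 + 1 by norm_num, contDiffOn_succ_iff_deriv_of_isOpen hs]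
  refine ⟨fun r hr => (hf r hr).differentiableAt.differentiableWithinAt, by simp, ?_⟩
  rw [contDiffOn_zero]
  exact hf'.congr fun r hr => (hf r hr).deriv

/-- The untruncated profile is `C¹` past `R`, which gives one-sided regularity at the boundary even
if the truncated one jumps. -/
theorem regularProfile_ite {f : ℝ → ℝ} {b R : ℝ} (hRb : R < b) (hc : ContinuousOn f (Icc 0 b))
    (hd : ContDiffOn ℝ 1 f (Ioo 0 b)) : RegularProfile R (fun r => if r ≤ R then f r else 0) :=
  ⟨(hc.mono (Icc_subset_Icc_right hRb.le)).congr fun _ hr => if_pos hr.2,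
    (hd.mono fun _ hr => ⟨hr.1, hr.2.trans_lt hRb⟩).congr fun _ hr => if_pos hr.2⟩

variable {hrad htan : ℝ → ℝ → ℝ} {lam mu a b c : ℝ} {Γ Υ : ℝ → ℝ → ℝ} {Xflat Xsharp : EReal}

/-- The global solution is cut at the first zero of the radial pressure, strictly before `x` reaches
`1`. The bounds on `x` and `y` along it are recorded since the hyperbolicity and mass estimates
follow from them. -/
theorem ConstitutiveAssumptions.exists_ball
    (hyp : ConstitutiveAssumptions hrad htan lam mu a b c Γ Υ Xflat Xsharp) {K l₀ : ℝ}
    (hK : 0 < K) (hl₀ : 0 < l₀) (hX : (Real.exp l₀ : EReal) < min Xflat Xsharp) :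
    ∃ (R : ℝ) (ρ prad ptan : ℝ → ℝ), IsRegularElasticBall hrad htan K R ρ prad ptan ∧
      ρ 0 = K * Real.exp l₀ ^ 3 ∧
      ∀ r ∈ Ioc 0 R, ∃ x y, 1 < x ∧ x < Real.exp l₀ ∧ 0 < y ∧ y < 1 ∧ eta K ρ r = x ^ 3 ∧
        delta K ρ r = x ^ 3 * y := by
  obtain ⟨hXf, hXs⟩ := lt_min_iff.1 hX
  have hpi := Real.pi_pos
  have hk := hyp.linear.elliptic
  have hΓC := hyp.global.gamma_C1
  set C := gravConst lam mu K with hC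
  have hC0 : 0 < C := by
    rw [hC, gravConst]
    positivity
  set B := coefB Γ Υ with hB
  set G := coefG Γ a b C with hG
  obtain ⟨c1, c2, c3⟩ := hyp.coef_center_pos hK hXf
  have hU := isOpen_regularDomain hyp.power_law.gamma_cont
  have hBU : ContDiffOn ℝ 1 B (regularDomain Γ) :=
    contDiffOn_coefB_regularDomain hΓC hyp.global.upsilon_C1
  have hGU : ContDiffOn ℝ 1 G (regularDomain Γ) := contDiffOn_coefG_regularDomain hΓC a b C
  obtain ⟨e, he, l, v, hlc, hvc, hl0, hv0, hle, hsol, hv, hl⟩ :=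
    (hyp.continuationHyp hC0 hXf).exists_global_solution hl₀
      (hBU.contDiffAt (hU.mem_nhds c1)) (hGU.contDiffAt (hU.mem_nhds c1)) c2 c3
  have hv1 : ∀ r ∈ Icc 0 e, v r < 1 := fun r hr => by
    rcases hr.1.eq_or_lt with rfl | h
    · rw [hv0]; exact one_pos
    · exact (hv r ⟨h, hr.2⟩).2
  have hx1 : ∀ r ∈ Ioo 0 e, 1 < Real.exp (l r) ∧ Real.exp (l r) < Real.exp l₀ := fun r hr =>
    ⟨Real.one_lt_exp_iff.2 (hl r hr).1, Real.exp_lt_exp.2 (hl r hr).2⟩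
  have hΓ : ∀ r ∈ Ioo 0 e, 0 < Γ (Real.exp (l r)) (1 - v r) := fun r hr =>
    hyp.gamma_pos (Real.exp_pos _) (lt_trans (by exact_mod_cast (hx1 r hr).2) hXf)
      (by linarith [hv1 r (Ioo_subset_Icc_self hr)])
      (by linarith [(hv r (Ioo_subset_Ioc_self hr)).1])
  have hreg : ∀ r ∈ Ioo 0 e, (l r, v r) ∈ regularDomain Γ := fun r hr =>
    ⟨hv1 r (Ioo_subset_Icc_self hr), hΓ r hr⟩
  have hlC : ContDiffOn ℝ 1 l (Ioo 0 e) := by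
    refine contDiffOn_one_of_hasDerivAt isOpen_Ioo (fun r hr => (hsol r hr).1) ?_
    exact (hvc.mono Ioo_subset_Icc_self).neg.div continuousOn_id fun r hr => hr.1.ne'
  have hvC : ContDiffOn ℝ 1 v (Ioo 0 e) := by
    refine contDiffOn_one_of_hasDerivAt isOpen_Ioo (fun r hr => (hsol r hr).2) ?_
    have hlv : ContinuousOn (fun r => (l r, v r)) (Ioo 0 e) :=
      (hlc.mono Ioo_subset_Icc_self).prodMk (hvc.mono Ioo_subset_Icc_self)
    have h1 := hBU.continuousOn.comp hlv hreg
    have h2 := hGU.continuousOn.comp hlv hreg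
    exact ((h1.neg.mul (hvc.mono Ioo_subset_Icc_self)).add
      ((continuousOn_pow 2).mul h2)).div continuousOn_id fun r hr => hr.1.ne'
  have hxyc : ContinuousOn (fun r => (Real.exp (l r), 1 - v r)) (Icc 0 e) :=
    hlc.rexp.prodMk (continuousOn_const.sub hvc)
  have hxyC : ContDiffOn ℝ 1 (fun r => (Real.exp (l r), 1 - v r)) (Ioo 0 e) :=
    hlC.exp.prodMk (contDiffOn_const.sub hvC)
  have hxym : MapsTo (fun r => (Real.exp (l r), 1 - v r)) (Icc 0 e) openQuadrant := fun r hr =>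
    ⟨Real.exp_pos _, sub_pos.2 (hv1 r hr)⟩
  set Pr : ℝ → ℝ := fun r => inXY hrad (Real.exp (l r)) (1 - v r) with hPr
  set Pt : ℝ → ℝ := fun r => inXY htan (Real.exp (l r)) (1 - v r) with hPt
  have hPrc : ContinuousOn Pr (Icc 0 e) := hyp.rad_C2.continuousOn.comp hxyc hxym
  have hPtc : ContinuousOn Pt (Icc 0 e) := hyp.tan_C2.continuousOn.comp hxyc hxym
  have hPrC : ContDiffOn ℝ 1 Pr (Ioo 0 e) :=
    (hyp.rad_C2.of_le (by norm_num)).comp hxyC (hxym.mono_left Ioo_subset_Icc_self)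
  have hPtC : ContDiffOn ℝ 1 Pt (Ioo 0 e) :=
    (hyp.tan_C2.of_le (by norm_num)).comp hxyC (hxym.mono_left Ioo_subset_Icc_self)
  have hPr0 : 0 < Pr 0 := by
    simp only [hPr, hl0, hv0, sub_zero]
    exact hyp.signs.center_pos _ (Real.one_lt_exp_iff.2 hl₀) hX
  have hPre : Pr e < 0 := by
    obtain ⟨h1, h2⟩ := hv e ⟨he, le_rfl⟩
    simp only [hPr, hle, Real.exp_zero]
    exact hyp.signs.neg_at_one _ (by linarith) (by linarith)
  obtain ⟨R, hR, hR0, hRpos⟩ := exists_first_zero he.le hPrc hPr0 hPre.le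
  have hRe : R < e := hR.2.lt_of_ne (by rintro rfl; linarith)
  have hsubc : Icc 0 R ⊆ Icc 0 e := Icc_subset_Icc_right hRe.le
  have hIoc : ∀ r ∈ Ioc 0 R, r ∈ Ioo 0 e := fun r hr => ⟨hr.1, hr.2.trans_lt hRe⟩
  set f : ℝ → ℝ := fun r => K * (Real.exp (l r) ^ 3 * (1 - v r)) with hf
  set ρ : ℝ → ℝ := fun r => if r ≤ R then f r else 0 with hρ
  have hρf : ∀ r ≤ R, ρ r = f r := fun r hr => if_pos hr
  have hfc : ContinuousOn f (Icc 0 e) := by fun_prop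
  have hfC : ContDiffOn ℝ 1 f (Ioo 0 e) :=
    contDiffOn_const.mul ((hlC.exp.pow 3).mul (contDiffOn_const.sub hvC))
  -- The equation `r ℓ' = -v` says that `K x³ r³ / 3` is a primitive of `ρ r²`, so the `x` of the
  -- solution is the `η^(1/3)` of the constructed density.
  have hmass : ∀ r ∈ Icc 0 R, mass ρ r = 4 * Real.pi / 3 * K * Real.exp (l r) ^ 3 * r ^ 3 := by
    intro r hr
    have hsubr : Icc 0 r ⊆ Icc 0 e := (Icc_subset_Icc_right hr.2).trans hsubc
    have h1 : ∫ s in (0 : ℝ)..r, ρ s * s ^ 2 =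
        K / 3 * Real.exp (l r) ^ 3 * r ^ 3 - K / 3 * Real.exp (l 0) ^ 3 * 0 ^ 3 := by
      refine intervalIntegral.integral_eq_sub_of_hasDerivAt_of_le
        (f := fun r => K / 3 * Real.exp (l r) ^ 3 * r ^ 3) hr.1 ?_ (fun s hs => ?_) ?_
      · have := hlc.mono hsubr
        fun_prop
      · have hs' : s ∈ Ioo 0 e := hIoc s ⟨hs.1, hs.2.le.trans hr.2⟩
        refine (((((hsol s hs').1.exp.fun_pow 3).const_mul (K / 3)).fun_mul
          (hasDerivAt_pow 3 s))).congr_deriv ?_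
        rw [hρf s (hs.2.le.trans hr.2), hf]
        have := hs.1.ne'
        push_cast
        field_simp
        ring
      · refine ContinuousOn.intervalIntegrable ?_
        rw [uIcc_of_le hr.1]
        refine ContinuousOn.mul ?_ (by fun_prop)
        exact (hfc.mono hsubr).congr fun s hs => hρf s (hs.2.trans hr.2)
    rw [mass, h1]
    ring
  have heta : ∀ r ∈ Ioc 0 R, eta K ρ r = Real.exp (l r) ^ 3 := by
    intro r hr
    have := hr.1
    rw [eta, hmass r (Ioc_subset_Icc_self hr)]
    field_simp
  have hdelta : ∀ r ≤ R, delta K ρ r = Real.exp (l r) ^ 3 * (1 - v r) := by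
    intro r hr
    rw [delta, hρf r hr, hf, mul_div_cancel_left₀ _ hK.ne']
  refine ⟨R, ρ, fun r => if r ≤ R then Pr r else 0, fun r => if r ≤ R then Pt r else 0,
    ⟨⟨hR.1, ?_, regularProfile_ite hRe hfc hfC, regularProfile_ite hRe hPrc hPrC,
      regularProfile_ite hRe hPtc hPtC, ?_, ?_, ?_, ?_, ?_, ?_⟩, ?_, ?_⟩, ?_, ?_⟩
  -- The density is still positive at the boundary, as `y > 0` there. Passing to the interior
  -- removes `R`.
  · have : {r : ℝ | 0 < r ∧ 0 < ρ r} = Ioc 0 R := by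
      ext r
      constructor
      · rintro ⟨h1, h2⟩
        refine ⟨h1, ?_⟩
        by_contra! h3
        simp only [hρ, if_neg (not_le.2 h3), lt_self_iff_false] at h2
      · intro hr
        refine ⟨hr.1, ?_⟩
        have h1 := sub_pos.2 (hv1 r (hsubc (Ioc_subset_Icc_self hr)))
        rw [hρf r hr.2, hf]
        positivity
    rw [this, interior_Ioc]
  -- By the mass formula `m / r² = (4π/3) K x³ r`, which is continuous up to the center.
  · refine ⟨fun r => ∫ s in (0 : ℝ)..r, 4 * Real.pi / 3 * K * Real.exp (l s) ^ 3 * s,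
      fun r hr => ?_⟩
    have hr' := hIoc r (Ioo_subset_Ioc_self hr)
    have hgc : ContinuousOn (fun s => 4 * Real.pi / 3 * K * Real.exp (l s) ^ 3 * s) (Icc 0 e) := by
      fun_prop
    have hΦ : HasDerivAt (fun r => ∫ s in (0 : ℝ)..r, 4 * Real.pi / 3 * K * Real.exp (l s) ^ 3 * s)
        (mass ρ r / r ^ 2) r := by
      have h1 := intervalIntegral.integral_hasDerivAt_right
        (f := fun s => 4 * Real.pi / 3 * K * Real.exp (l s) ^ 3 * s) (a := 0) (b := r)
        (ContinuousOn.intervalIntegrable (by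
          rw [uIcc_of_le hr.1.le]; exact hgc.mono (Icc_subset_Icc_right hr'.2.le)))
        (ContinuousAt.stronglyMeasurableAtFilter isOpen_Ioo
          (fun t ht => hgc.continuousAt (Icc_mem_nhds ht.1 ht.2)) r hr')
        (hgc.continuousAt (Icc_mem_nhds hr'.1 hr'.2))
      refine h1.congr_deriv ?_
      have := hr.1
      rw [hmass r (Ioo_subset_Icc_self hr)]
      field_simp
    refine ⟨hΦ, ?_⟩
    rw [hΦ.deriv]
    have hev : (fun r => if r ≤ R then Pr r else 0) =ᶠ[𝓝 r] Pr := by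
      filter_upwards [gt_mem_nhds hr.2] with t ht using if_pos ht.le
    obtain ⟨s1, s2⟩ := hsol r hr'
    have hd := hasDerivAt_comp_quadrant hyp.rad_C2 s1.exp (s2.const_sub 1) (Real.exp_pos _)
      (sub_pos.2 (hreg r hr').1)
    refine (hd.congr_of_eventuallyEq hev).congr_deriv ?_
    rw [(hyp.equilibrium_iff hr'.1 (hreg r hr').1 (hΓ r hr')).2 rfl, if_pos hr.2.le,
      if_pos hr.2.le, hρf r hr.2.le, hmass r (Ioo_subset_Icc_self hr)]
    simp only [hf, hPr, hPt]
    ring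
  · intro r hr
    simp only [if_pos hr.2.le]
    exact hRpos r hr
  · intro r hr
    simp only [if_pos hr.2.le]
    rcases hr.1.eq_or_lt with rfl | h
    · simp only [hPr, hl0, hv0, sub_zero] at hPr0
      simp only [hPt, hl0, hv0, sub_zero, ← hyp.equal_center _ (Real.exp_pos _)]
      exact hPr0
    · have hr' := hIoc r ⟨h, hr.2.le⟩
      obtain ⟨h1, h2⟩ := hv r (Ioo_subset_Ioc_self hr')
      exact hyp.tangential.ptan_pos _ _ (Real.exp_pos _)
        (lt_trans (by exact_mod_cast (hx1 r hr').2) hXs) (by linarith) (by linarith)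
        (hRpos r hr).le
  · simp only [if_pos le_rfl]
    exact hR0
  · simp only [if_pos hR.1.le, hPr, hPt, hv0, sub_zero]
    exact hyp.equal_center _ (Real.exp_pos _)
  · intro r hr
    simp only [hρ, if_neg (not_le.2 hr), and_self]
  · intro r hr
    simp only [if_pos hr.2, heta r hr, hdelta r hr.2, hPr, inXY]
  · intro r hr
    simp only [if_pos hr.2, heta r hr, hdelta r hr.2, hPt, inXY]
  · rw [hρf 0 hR.1.le, hf]
    simp only [hl0, hv0, sub_zero, mul_one]
  · intro r hr
    have hr' := hIoc r hr
    obtain ⟨h1, h2⟩ := hv r (Ioo_subset_Ioc_self hr')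
    exact ⟨Real.exp (l r), 1 - v r, (hx1 r hr').1, (hx1 r hr').2, by linarith, by linarith,
      heta r hr, hdelta r hr.2⟩

/-! ### The thresholds -/

theorem exists_cube_eq {d : ℝ} (hd : 0 < d) : ∃ x : ℝ, 0 < x ∧ x ^ 3 = d :=
  ⟨d ^ (1 / 3 : ℝ), by positivity, by
    rw [← Real.rpow_natCast, ← Real.rpow_mul hd.le]
    norm_num⟩

theorem coe_cube_lt_cube_iff {X : EReal} (hX : 1 < X) {x : ℝ} :
    ((x ^ 3 : ℝ) : EReal) < X ^ 3 ↔ (x : EReal) < X := by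
  induction X with
  | bot => simp at hX
  | coe X =>
    rw [← EReal.coe_pow, EReal.coe_lt_coe_iff, EReal.coe_lt_coe_iff]
    exact (Odd.strictMono_pow (by decide)).lt_iff_lt
  | top =>
    have h : (⊤ : EReal) ^ 3 = ⊤ := by simp [pow_succ]
    rw [h]
    exact iff_of_true (EReal.coe_lt_top _) (EReal.coe_lt_top _)

theorem exists_of_cube_eq_coe {X : EReal} (hX : 1 < X) {d : ℝ} (h : X ^ 3 = (d : EReal)) :
    ∃ x : ℝ, X = (x : EReal) ∧ 0 < x ∧ x ^ 3 = d := by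
  induction X with
  | bot => simp at hX
  | coe X =>
    refine ⟨X, rfl, ?_, ?_⟩
    · have : (1 : ℝ) < X := by exact_mod_cast hX
      linarith
    · exact_mod_cast h
  | top => simp [pow_succ] at h

theorem one_lt_cube {X : EReal} (hX : 1 < X) : 1 < X ^ 3 := by
  have := (coe_cube_lt_cube_iff hX (x := 1)).2 (by exact_mod_cast hX)
  simpa using this

theorem ConstitutiveAssumptions.gamma_eq_mul
    (hyp : ConstitutiveAssumptions hrad htan lam mu a b c Γ Υ Xflat Xsharp) {x y : ℝ}
    (hx : 0 < x) (hy : 0 < y) : ∃ A > 0, Γ x y = A * d1 hrad (x ^ 3 * y) (x ^ 3) := by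
  have hk := hyp.linear.elliptic
  refine ⟨(lam + 2 * mu)⁻¹ * x ^ a * y ^ b * x ^ 3, by positivity, ?_⟩
  rw [hyp.power_law.gamma_eq x y hx hy, d2_inXY]
  ring

theorem ConstitutiveAssumptions.d1_pos
    (hyp : ConstitutiveAssumptions hrad htan lam mu a b c Γ Υ Xflat Xsharp) {x y : ℝ}
    (hx : 0 < x) (hy : 0 < y) (h : 0 < Γ x y) : 0 < d1 hrad (x ^ 3 * y) (x ^ 3) := by
  obtain ⟨A, hA, hΓ⟩ := hyp.gamma_eq_mul hx hy
  rw [hΓ] at h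
  exact (mul_pos_iff_of_pos_left hA).1 h

theorem ConstitutiveAssumptions.isDeltaFlat
    (hyp : ConstitutiveAssumptions hrad htan lam mu a b c Γ Υ Xflat Xsharp) :
    IsDeltaFlat hrad (Xflat ^ 3) := by
  have h1 := hyp.central.one_lt
  refine ⟨one_lt_cube h1, fun δ hδ hlt => ?_, fun δ hδ => ?_⟩
  · obtain ⟨x, hx, rfl⟩ := exists_cube_eq hδ
    simpa using hyp.d1_pos hx one_pos
      (hyp.central.gamma_pos x hx ((coe_cube_lt_cube_iff h1).1 hlt))
  · obtain ⟨x, hX, hx, rfl⟩ := exists_of_cube_eq_coe h1 hδ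
    obtain ⟨A, hA, hΓ⟩ := hyp.gamma_eq_mul hx one_pos
    rw [hyp.central.gamma_flat x hX] at hΓ
    simpa [hA.ne'] using hΓ.symm

/-- If two thresholds differed, the derivative at the smaller one would be zero by its own property
and positive by that of the larger. -/
theorem IsDeltaFlat.unique {D D' : EReal} (h : IsDeltaFlat hrad D) (h' : IsDeltaFlat hrad D') :
    D' = D := by
  have key : ∀ {D D' : EReal}, IsDeltaFlat hrad D → IsDeltaFlat hrad D' → ¬ D' < D := by
    intro D D' h h' hlt
    have h1 := h'.one_lt
    induction D' with
    | bot => simp at h1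
    | coe d =>
      have hd : (1 : ℝ) < d := by exact_mod_cast h1
      exact (h.pos d (by linarith) hlt).ne' (h'.zero d rfl)
    | top => simp at hlt
  exact le_antisymm (not_lt.1 (key h' h)) (not_lt.1 (key h h'))

theorem ConstitutiveAssumptions.isDeltaSharp
    (hyp : ConstitutiveAssumptions hrad htan lam mu a b c Γ Υ Xflat Xsharp) :
    IsDeltaSharp hrad htan (Xsharp ^ 3) := by
  have h1 := hyp.tangential.one_lt
  refine ⟨one_lt_cube h1, fun δ η hη hlt hδ hδη hp => ?_, fun d hd => ?_⟩
  · obtain ⟨x, hx, rfl⟩ := exists_cube_eq hη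
    have h3 : 0 < x ^ 3 := by positivity
    have := hyp.tangential.ptan_pos x (δ / x ^ 3) hx ((coe_cube_lt_cube_iff h1).1 hlt)
      (by positivity) ((div_lt_one h3).2 hδη)
    simp only [inXY, mul_div_cancel₀ _ h3.ne'] at this
    exact this hp
  · obtain ⟨x, hX, hx, rfl⟩ := exists_of_cube_eq_coe h1 hd
    have h3 : 0 < x ^ 3 := by positivity
    rintro ⟨δ, hδ, h0⟩
    obtain ⟨y, hy, hy1, hy2⟩ := hyp.tangential.boundary x hX
      ⟨δ / x ^ 3, ⟨div_pos hδ.1 h3, (div_lt_one h3).2 hδ.2⟩, by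
        simpa only [inXY, mul_div_cancel₀ _ h3.ne'] using h0⟩
    exact ⟨x ^ 3 * y, ⟨mul_pos h3 hy.1, mul_lt_of_lt_one_right h3 hy.2⟩, hy1, hy2⟩

/-- A common zero of both pressures at `η = D` violates the implication for any larger threshold; if
`D = ∞` nothing is larger. -/
theorem IsDeltaSharp.isGreatest {D : EReal} (h : IsDeltaSharp hrad htan D)
    (hz : ∀ d : ℝ, D = (d : EReal) → ∃ δ ∈ Ioo (0 : ℝ) d, hrad δ d = 0) :
    IsGreatest {D' : EReal | TanPositiveBelow hrad htan D'} D := by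
  refine ⟨h.pos, fun D' hD' => ?_⟩
  by_contra! hlt
  have h1 := h.one_lt
  induction D with
  | bot => simp at h1
  | coe d =>
    have hd : (1 : ℝ) < d := by exact_mod_cast h1
    obtain ⟨δ, hδ, e1, e2⟩ := h.boundary d rfl (hz d rfl)
    exact (hD' δ d (by linarith) hlt hδ.1 hδ.2 e1.ge).ne' e2
  | top => simp at hlt

end ElasticBall

/-! ### The main theorem -/

theorem theorem2 (hrad htan : ℝ → ℝ → ℝ) (lam mu a b c : ℝ) (Γ Υ : ℝ → ℝ → ℝ)
    (Xflat Xsharp : EReal)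
    (hyp : ElasticBall.ConstitutiveAssumptions hrad htan lam mu a b c Γ Υ Xflat Xsharp) :
    ∃ Dflat Dsharp D : EReal,
      -- the threshold and how the constitutive functions determine it
      Dflat = Xflat ^ 3 ∧ Dsharp = Xsharp ^ 3 ∧ D = min Dflat Dsharp ∧ 1 < D ∧
      ElasticBall.IsDeltaFlat hrad Dflat ∧
      (∀ D' : EReal, ElasticBall.IsDeltaFlat hrad D' → D' = Dflat) ∧
      ElasticBall.IsDeltaSharp hrad htan Dsharp ∧
      ((∀ d : ℝ, Dsharp = (d : EReal) → ∃ δ ∈ Set.Ioo (0 : ℝ) d, hrad δ d = 0) →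
        IsGreatest {D' : EReal | ElasticBall.TanPositiveBelow hrad htan D'} Dsharp) ∧
      -- elastic balls with central density `ρc` and reference density `K`
      ∀ ρc K : ℝ, 0 < ρc → 0 < K → 1 < ρc / K → ((ρc / K : ℝ) : EReal) < D →
        0 < hrad (ρc / K) (ρc / K) ∧
        0 < ElasticBall.d1 hrad (ρc / K) (ρc / K) ∧
        ∃ (R : ℝ) (ρ prad ptan : ℝ → ℝ),
          ElasticBall.IsRegularElasticBall hrad htan K R ρ prad ptan ∧ ρ 0 = ρc ∧
          (∀ (R' : ℝ) (ρ' prad' ptan' : ℝ → ℝ),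
            ElasticBall.IsRegularElasticBall hrad htan K R' ρ' prad' ptan' → ρ' 0 = ρc →
            R' = R ∧ ∀ r : ℝ, 0 ≤ r → ρ' r = ρ r ∧ prad' r = prad r ∧ ptan' r = ptan r) ∧
          ∀ r ∈ Set.Ioc 0 R,
            0 < ElasticBall.d1 hrad (ElasticBall.delta K ρ r) (ElasticBall.eta K ρ r) ∧
            ρ r < ρc ∧
            4 * Real.pi / 3 * max (ρ r) K * r ^ 3 < ElasticBall.mass ρ r ∧
            ElasticBall.mass ρ r < 4 * Real.pi / 3 * ρc * r ^ 3 := by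
  have hf1 := hyp.central.one_lt
  have hs1 := hyp.tangential.one_lt
  refine ⟨Xflat ^ 3, Xsharp ^ 3, _, rfl, rfl, rfl,
    lt_min (ElasticBall.one_lt_cube hf1) (ElasticBall.one_lt_cube hs1), hyp.isDeltaFlat,
    fun D' hD' => hyp.isDeltaFlat.unique hD', hyp.isDeltaSharp, hyp.isDeltaSharp.isGreatest,
    fun ρc K hρc hK hδ hlt => ?_⟩
  obtain ⟨hltf, hlts⟩ := lt_min_iff.1 hlt
  obtain ⟨x, hx, hx3⟩ := ElasticBall.exists_cube_eq (show 0 < ρc / K by positivity)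
  rw [← hx3] at hltf hlts hδ ⊢
  have hxf := (ElasticBall.coe_cube_lt_cube_iff hf1).1 hltf
  have hxs := (ElasticBall.coe_cube_lt_cube_iff hs1).1 hlts
  have hxX : (x : EReal) < min Xflat Xsharp := lt_min hxf hxs
  have hx1 : 1 < x := by
    by_contra! h
    exact absurd (pow_le_one₀ hx.le h) (not_le.2 hδ)
  have hexp : Real.exp (Real.log x) = x := Real.exp_log hx
  have hKx : K * x ^ 3 = ρc := by rw [hx3, mul_div_cancel₀ _ hK.ne']
  obtain ⟨R, ρ, prad, ptan, ball, hρ0, hprof⟩ := hyp.exists_ball hK (Real.log_pos hx1)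
    (by rw [hexp]; exact hxX)
  rw [hexp] at hprof
  rw [hexp, hKx] at hρ0
  refine ⟨?_, ?_, R, ρ, prad, ptan, ball, hρ0, fun R' ρ' prad' ptan' ball' h0' => ?_,
    fun r hr => ?_⟩
  · simpa [ElasticBall.inXY] using hyp.signs.center_pos x hx1 hxX
  · simpa using hyp.d1_pos hx one_pos (hyp.central.gamma_pos x hx hxf)
  -- Only the constructed ball must be shown to stay where `Γ > 0`; the competitor is arbitrary.
  · refine hyp.ball_unique hK ball (hρ0 ▸ hρc) ?_ (fun r hr => ?_) ball' (h0'.trans hρ0.symm)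
    · have : ElasticBall.logX K ρ 0 = Real.log x := by
        rw [ElasticBall.logX, if_pos rfl, hρ0, ← hx3, Real.log_pow]
        push_cast
        ring
      rw [this, hexp]
      exact hxf
    · obtain ⟨z, y, hz1, hzx, hy0, hy1, hη, hδ'⟩ := hprof r (Ioo_subset_Ioc_self hr)
      have hz : 0 < z := by linarith
      have h3 : 0 < z ^ 3 := by positivity
      have e1 : ElasticBall.logX K ρ r = Real.log z := by
        rw [ElasticBall.logX, if_neg hr.1.ne', hη, Real.log_pow]
        push_cast
        ring
      have e2 : ElasticBall.oneSubY K ρ r = 1 - y := by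
        rw [ElasticBall.oneSubY, if_neg hr.1.ne', hη, hδ', mul_div_cancel_left₀ _ h3.ne']
      rw [e1, e2]
      refine ⟨by simpa using hy0, ?_⟩
      simp only [Real.exp_log hz, sub_sub_cancel]
      exact hyp.gamma_pos hz (lt_trans (by exact_mod_cast hzx) hxf) hy0.le hy1.le
  · obtain ⟨z, y, hz1, hzx, hy0, hy1, hη, hδ'⟩ := hprof r hr
    have hz : 0 < z := by linarith
    have hr0 := hr.1
    have hpi := Real.pi_pos
    have hzx3 : z ^ 3 < x ^ 3 := pow_lt_pow_left₀ hzx hz.le (by norm_num)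
    have hz3 : 1 < z ^ 3 := one_lt_pow₀ hz1 (by norm_num)
    have hρr : ρ r = K * (z ^ 3 * y) := by
      rw [← hδ', ElasticBall.delta, mul_div_cancel₀ _ hK.ne']
    have hzy : z ^ 3 * y < z ^ 3 := mul_lt_of_lt_one_right (by positivity) hy1
    -- With `η = z³` and `δ = z³ y`, the mass and density bounds reduce to `1 < z < x` and `y < 1`.
    have hm : ElasticBall.mass ρ r = 4 * Real.pi / 3 * (K * z ^ 3) * r ^ 3 := by
      rw [ElasticBall.mass_eq_eta hK hr0, hη]
      ring
    refine ⟨?_, ?_, ?_, ?_⟩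
    · rw [hη, hδ']
      exact hyp.d1_pos hz hy0
        (hyp.gamma_pos hz (lt_trans (by exact_mod_cast hzx) hxf) hy0.le hy1.le)
    · rw [hρr, ← hKx]
      gcongr
      exact hzy.trans hzx3
    · rw [hm]
      gcongr
      refine max_lt ?_ ?_
      · rw [hρr]
        gcongr
      · exact lt_mul_of_one_lt_right hK hz3
    · rw [hm, ← hKx]
      gcongr
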